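/- **Theorem 3.1.** Let $D\in\mathbb{R}^{n\times k}$, let $\mathcal X,\tilde{\mathcal X}$ be $k$-dimensional subspaces of $\mathbb{R}^n$, and let $X,\tilde X\in\mathbb{R}^{n\times k}$ satisfy $$X^TX=\tilde X^T\tilde X=I_k,\quad \mathcal R(X)=\mathcal X,\quad \mathcal R(\tilde X)=\tilde{\mathcal X},\quad X^TD\succeq0,\quad \tilde X^TD\succeq0,\quad \operatorname{rank}(X^TD)=\operatorname{rank}(\tilde X^TD)=:r,$$ where $A\succeq 0$ means that $A$ is symmetric positive semidefinite. Let $\sigma_r,\tilde\sigma_r$ be the $r$-th largest singular values of $X^TD$ and $\tilde X^TD$; if $r=0$, all terms below that contain $\sigma_r,\tilde\sigma_r$ are to be omitted. Let $$\mathbb X=\{Y\in\mathbb{R}^{n\times k}: Y^TY=I_k,\ \mathcal R(Y)=\mathcal X,\ Y^TD\succeq0\},$$ and let $\sin\Theta(\mathcal X,\tilde{\mathcal X})=\operatorname{diag}(\sin\theta_1,\dots,\sin\theta_k)$, where $\theta_i=\arccos\omega_{k-i+1}$ and $\omega_1\ge\dots\ge\omega_k$ are the singular values of $X^T\tilde X$.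 (i) For every decomposition $X^TD=[V_1,V_2]\operatorname{diag}(\Sigma_1,0)[V_1,V_2]^T$ with $[V_1,V_2]\in\mathbb{R}^{k\times k}$ orthogonal, $V_1\in\mathbb{R}^{k\times r}$, and $\Sigma_1$ diagonal with positive non-increasing diagonal entries, $$\mathbb X=\{XV_1V_1^T+XV_2WV_2^T:\ W\in\mathbb{R}^{(k-r)\times(k-r)}\text{ orthogonal}\};$$ in particular $\mathbb X=\{X\}$ if $r=k$. (ii) Let $\|\cdot\|$ be a dimension-free unitarily invariant norm, that is, a norm on the real matrices of each size that is invariant under multiplication by orthogonal matrices from the left and from the right and does not change when a matrix is bordered by zero rows and columns. Then the following minimum is attained and $$\min_{Y\in\mathbb X}\|\tilde X-Y\|\le\eta\,\|\sin\Theta(\mathcal X,\tilde{\mathcal X})\|,$$ $$\eta=\begin{cases}\sqrt2\left(1+\dfrac{2\|D\|_2}{\sigma_k+\tilde\sigma_k}\right), & r=k,\\[2ex] \sqrt2\left(1+\dfrac{2\|D\|_2}{\sigma_r+\tilde\sigma_r}\right)+\dfrac{(2\sqrt2+4)\|D\|_2}{\max\{\sigma_r,\tilde\sigma_r\}}, &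 r<k.\end{cases}$$ (iii) If $r<k$, the same inequality holds for the Frobenius norm $\|\cdot\|_F$ with $$\eta=\sqrt2\left(1+\frac{2\|D\|_2}{\sigma_r+\tilde\sigma_r}\right)+\frac{4\|D\|_2}{\max\{\sigma_r,\tilde\sigma_r\}},$$ and for the spectral norm $\|\cdot\|_2$ with $$\eta=\sqrt2+\sqrt{\frac{8\|D\|_2^2}{(\sigma_r+\tilde\sigma_r)^2}+\frac{4\|D\|_2^2}{[\max\{\sigma_r,\tilde\sigma_r\}]^2}}+\frac{4\|D\|_2}{\max\{\sigma_r,\tilde\sigma_r\}}.$$ -/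

import Mathlib

open scoped Matrix

/-- The `i`-th largest singular value `σ_i(A)` of a real matrix, `i = 1, 2, …`
(Mathlib numbers singular values from `0`); used only for `1 ≤ i`. -/
noncomputable def sigma {m n : ℕ} (A : Matrix (Fin m) (Fin n) ℝ) (i : ℕ) : ℝ :=
  (Matrix.toEuclideanLin A).singularValues (i - 1)

open scoped Matrix.Norms.L2Operator in
/-- The spectral norm `‖A‖₂`. -/
noncomputable def spectralNorm2 {m n : ℕ} (A : Matrix (Fin m) (Fin n) ℝ) : ℝ := ‖A‖

open scoped Matrix.Norms.Frobenius in
/-- The Frobenius norm `‖A‖_F`. -/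
noncomputable def frobeniusNorm {m n : ℕ} (A : Matrix (Fin m) (Fin n) ℝ) : ℝ := ‖A‖

/-- A dimension-free unitarily invariant norm: a norm on the real matrices of each size, invariant
under orthogonal transformations from both sides, such that the norms on different sizes are
consistent, i.e. bordering a matrix by zero rows and columns does not change its norm. -/
structure UnitarilyInvariantNorm where
  toFun : ∀ {m n : ℕ}, Matrix (Fin m) (Fin n) ℝ → ℝ
  add_le : ∀ {m n : ℕ} (A B : Matrix (Fin m) (Fin n) ℝ), toFun (A + B) ≤ toFun A + toFun B
  smul : ∀ {m n : ℕ} (c : ℝ) (A : Matrix (Fin m) (Fin n) ℝ), toFun (c • A) = |c| * toFun A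
  eq_zero : ∀ {m n : ℕ} (A : Matrix (Fin m) (Fin n) ℝ), toFun A = 0 → A = 0
  invariant : ∀ {m n : ℕ} (A : Matrix (Fin m) (Fin n) ℝ),
    ∀ U ∈ Matrix.orthogonalGroup (Fin m) ℝ, ∀ V ∈ Matrix.orthogonalGroup (Fin n) ℝ,
      toFun (U * A * V) = toFun A
  border : ∀ {m n : ℕ} (p q : ℕ) (A : Matrix (Fin m) (Fin n) ℝ),
    toFun (Matrix.reindex finSumFinEquiv finSumFinEquiv
      (Matrix.fromBlocks A 0 0 (0 : Matrix (Fin p) (Fin q) ℝ))) = toFun A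

/-- `X` is an orthonormal basis matrix of the subspace `S`: `Xᵀ X = I_k` and `R(X) = S`. -/
def IsOrthonormalBasisMatrix {n k : ℕ} (X : Matrix (Fin n) (Fin k) ℝ)
    (S : Submodule ℝ (Fin n → ℝ)) : Prop :=
  Xᵀ * X = 1 ∧ LinearMap.range X.mulVecLin = S

/-- The `i`-th canonical angle `θ_i = arccos ω_{k-i+1}` between the column spaces of `X` and `X'`
(matrices with orthonormal columns), where `ω_1 ≥ ⋯ ≥ ω_k` are the singular values of `Xᵀ X'`.
Here `i : Fin k` stands for the index `i + 1`. -/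
noncomputable def canonicalAngle {n k : ℕ} (X X' : Matrix (Fin n) (Fin k) ℝ) (i : Fin k) : ℝ :=
  Real.arccos (sigma (Xᵀ * X') (k - i))

/-- The `k × k` matrix `sin Θ = diag(sin θ_1, …, sin θ_k)`. -/
noncomputable def sinTheta {n k : ℕ} (X X' : Matrix (Fin n) (Fin k) ℝ) :
    Matrix (Fin k) (Fin k) ℝ :=
  Matrix.diagonal fun i => Real.sin (canonicalAngle X X' i)

/-- The set of the orthonormal basis matrices `Y` of `S` with `Yᵀ D ⪰ 0`. -/
def admissibleBases {n k : ℕ} (D : Matrix (Fin n) (Fin k) ℝ) (S : Submodule ℝ (Fin n → ℝ)) :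
    Set (Matrix (Fin n) (Fin k) ℝ) :=
  {Y | IsOrthonormalBasisMatrix Y S ∧ (Yᵀ * D).PosSemidef}

/-- `H = V diag(σ_1, …, σ_r, 0, …, 0) Vᵀ` with `V = [V₁, V₂]` orthogonal and
`σ_1 ≥ ⋯ ≥ σ_r > 0`: a singular value decomposition of a positive semidefinite `H`. -/
def IsSymmSVD {k r : ℕ} (H : Matrix (Fin k) (Fin k) ℝ) (V₁ : Matrix (Fin k) (Fin r) ℝ)
    (V₂ : Matrix (Fin k) (Fin (k - r)) ℝ) (s : Fin r → ℝ) : Prop :=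
  (Matrix.fromCols V₁ V₂)ᵀ * Matrix.fromCols V₁ V₂ = 1 ∧
  Matrix.fromCols V₁ V₂ * (Matrix.fromCols V₁ V₂)ᵀ = 1 ∧
  Antitone s ∧ (∀ i, 0 < s i) ∧
  H = Matrix.fromCols V₁ V₂ *
    (Matrix.fromBlocks (Matrix.diagonal s) 0 0 0 :
      Matrix (Fin r ⊕ Fin (k - r)) (Fin r ⊕ Fin (k - r)) ℝ) * (Matrix.fromCols V₁ V₂)ᵀ

/-- The set `{X V₁ V₁ᵀ + X V₂ W V₂ᵀ : W orthogonal of order k - r}`. -/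
def basisFamily {n k r : ℕ} (X : Matrix (Fin n) (Fin k) ℝ) (V₁ : Matrix (Fin k) (Fin r) ℝ)
    (V₂ : Matrix (Fin k) (Fin (k - r)) ℝ) : Set (Matrix (Fin n) (Fin k) ℝ) :=
  {Y | ∃ W ∈ Matrix.orthogonalGroup (Fin (k - r)) ℝ, Y = X * V₁ * V₁ᵀ + X * V₂ * W * V₂ᵀ}

/-- The constant for an arbitrary unitarily invariant norm; `d = ‖D‖₂` and `s`, `t` are the
`r`-th singular values of `Xᵀ D` and `X'ᵀ D`. There is no `r`-th singular value if `r = 0`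
(then `Xᵀ D = X'ᵀ D = 0`), and the terms that contain `s` and `t` are absent. -/
noncomputable def eta (k r : ℕ) (d s t : ℝ) : ℝ :=
  if r = 0 then √2
  else if r = k then √2 * (1 + 2 * d / (s + t))
  else √2 * (1 + 2 * d / (s + t)) + (2 * √2 + 4) * d / max s t

/-- The improved constant for the Frobenius norm in the case `r < k`. -/
noncomputable def etaFrobenius (r : ℕ) (d s t : ℝ) : ℝ :=
  if r = 0 then √2
  else √2 * (1 + 2 * d / (s + t)) + 4 * d / max s t

/-- The improved constant for the spectral norm in the case `r < k`. -/
noncomputable def etaSpectral (r : ℕ) (d s t : ℝ) : ℝ :=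
  if r = 0 then √2
  else √2 + √(8 * d ^ 2 / (s + t) ^ 2 + 4 * d ^ 2 / max s t ^ 2) + 4 * d / max s t

/-! Write `H = XᵀD`, `H' = X'ᵀD`. By uniqueness of positive semidefinite square roots the admissible
bases are the `X G` with `G` orthogonal and `GᵀH = H` (`admissibleBases_eq_image`); such `G` fix the
range of `H` and rotate its kernel freely, so `G = V₁V₁ᵀ + V₂WV₂ᵀ`. This set is compact and the
norms are continuous, so the minimum exists, and it remains to choose a good `W`.

Let `Z` be the orthogonal polar factor of `XᵀX'`. Then `‖X' - XZ‖ ≤ √2 ‖sin Θ‖` (`exists_alignment`,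
`norm_sinTheta`), and `H - ZH' = -Z(X' - XZ)ᵀD` has norm at most `ε = √2 ‖D‖₂ ‖sin Θ‖`. With `H' =
U₁ diag(t) U₁ᵀ` and `U₂` completing `U₁`, one has `G - Z = (V₁V₁ᵀ - ZU₁U₁ᵀ) + (V₂WV₂ᵀ - ZU₂U₂ᵀ)`.
The first term is a difference of subunitary polar factors. Cut into blocks along `[V₁, V₂]` and
`[U₁, U₂]`, it has a block governed by a Sylvester equation (`2ε/(σ+τ)`), two off-diagonal blocks
(`ε/max σ τ` each) and a zero block. How the blocks are reassembled distinguishes the general,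
Frobenius and spectral constants. The second term is made small by building `W` from two polar
alignments (`exists_rotation`).

All norms are treated at once as a `GramNorm`: a seminorm that sees only `AᵀA` and ignores
transposition. Isometries then drop out, and `AᵀA ≤ BᵀB` implies `‖A‖ ≤ ‖B‖`. -/

open scoped MatrixOrder in
theorem Matrix.PosSemidef.exists_sqrt {n : Type*} [Fintype n] [DecidableEq n] {S : Matrix n n ℝ}
    (hS : S.PosSemidef) : ∃ K : Matrix n n ℝ, K.PosSemidef ∧ K * K = S :=
  ⟨CFC.sqrt S, Matrix.nonneg_iff_posSemidef.1 (CFC.sqrt_nonneg S),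
    CFC.sqrt_mul_sqrt_self S (Matrix.nonneg_iff_posSemidef.2 hS)⟩

open scoped MatrixOrder in
theorem Matrix.PosSemidef.eq_of_mul_self_eq {n : Type*} [Fintype n] [DecidableEq n]
    {A B : Matrix n n ℝ} (hA : A.PosSemidef) (hB : B.PosSemidef) (h : A * A = B * B) : A = B := by
  rw [← CFC.sqrt_mul_self A (Matrix.nonneg_iff_posSemidef.2 hA), h,
    CFC.sqrt_mul_self B (Matrix.nonneg_iff_posSemidef.2 hB)]

theorem Matrix.PosSemidef.transpose_eq {n : Type*} [Fintype n] {S : Matrix n n ℝ}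
    (hS : S.PosSemidef) : Sᵀ = S := by
  simpa [Matrix.IsHermitian, Matrix.conjTranspose_eq_transpose_of_trivial] using hS.isHermitian

theorem Matrix.posSemidef_transpose_mul_self {m n : Type*} [Fintype m] [Fintype n]
    (A : Matrix m n ℝ) : (Aᵀ * A).PosSemidef := by
  simpa [Matrix.conjTranspose_eq_transpose_of_trivial] using
    Matrix.posSemidef_conjTranspose_mul_self A

/-- Matrices with equal Gram matrices differ by an orthogonal factor on the left. -/
theorem exists_orthogonal_of_gram_eq {m n : Type*} [Fintype m] [DecidableEq m] [Fintype n]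
    [DecidableEq n] (A B : Matrix m n ℝ) (h : Aᵀ * A = Bᵀ * B) :
    ∃ U : Matrix m m ℝ, Uᵀ * U = 1 ∧ A = U * B := by
  set f := Matrix.toEuclideanLin A
  set g := Matrix.toEuclideanLin B
  have hinner : ∀ (C : Matrix m n ℝ) x, ‖Matrix.toEuclideanLin C x‖ ^ 2
      = x.ofLp ⬝ᵥ ((Cᵀ * C) *ᵥ x.ofLp) := by
    intro C x
    rw [EuclideanSpace.norm_sq_eq, ← Matrix.mulVec_mulVec, Matrix.dotProduct_mulVec,
      Matrix.vecMul_transpose]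
    simp [dotProduct, Matrix.toLpLin_apply, sq]
  have hfg : ∀ x, ‖f x‖ = ‖g x‖ := by
    intro x
    have := (hinner A x).trans (by rw [h, ← hinner B x])
    exact (sq_eq_sq₀ (norm_nonneg _) (norm_nonneg _)).1 this
  have hker : LinearMap.ker g ≤ LinearMap.ker f := by
    intro x hx
    rw [LinearMap.mem_ker] at hx ⊢
    rw [← norm_eq_zero, hfg, hx, norm_zero]
  set L₀ : LinearMap.range g →ₗ[ℝ] EuclideanSpace ℝ m :=
    (LinearMap.ker g).liftQ f hker ∘ₗ g.quotKerEquivRange.symm.toLinearMap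
  have hL₀ : ∀ x, L₀ ⟨g x, LinearMap.mem_range_self g x⟩ = f x := by
    intro x
    have : (⟨g x, LinearMap.mem_range_self g x⟩ : LinearMap.range g)
      = g.quotKerEquivRange (Submodule.Quotient.mk x) := rfl
    simp [L₀, this]
  let L : LinearMap.range g →ₗᵢ[ℝ] EuclideanSpace ℝ m := ⟨L₀, by
    rintro ⟨_, x, rfl⟩
    rw [hL₀, hfg]; rfl⟩
  set U := Matrix.toEuclideanLin.symm L.extend.toLinearMap
  have hU : Matrix.toEuclideanLin U = L.extend.toLinearMap := by simp [U]
  refine ⟨U, ?_, ?_⟩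
  · apply Matrix.toEuclideanLin.injective
    refine LinearMap.ext fun x => ext_inner_right ℝ fun y => ?_
    have h2 : Matrix.toEuclideanLin (Uᵀ * U) x
        = LinearMap.adjoint (Matrix.toEuclideanLin U) (Matrix.toEuclideanLin U x) := by
      rw [← Matrix.toEuclideanLin_conjTranspose_eq_adjoint,
        Matrix.conjTranspose_eq_transpose_of_trivial]
      simp [Matrix.toLpLin_apply, Matrix.mulVec_mulVec]
    rw [h2, LinearMap.adjoint_inner_left, hU]
    simp
  · apply Matrix.toEuclideanLin.injective
    refine LinearMap.ext fun x => ?_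
    have h2 : Matrix.toEuclideanLin (U * B) x = Matrix.toEuclideanLin U (g x) := by
      simp [g, Matrix.toLpLin_apply, Matrix.mulVec_mulVec]
    rw [h2, hU]
    change f x = L.extend (g x)
    rw [← hL₀ x]
    exact (L.extend_apply ⟨g x, LinearMap.mem_range_self g x⟩).symm

/-- The square root of `AᵀA` has the same Gram matrix as `A`. -/
theorem exists_polar {n : Type*} [Fintype n] [DecidableEq n] (A : Matrix n n ℝ) :
    ∃ T N : Matrix n n ℝ, Tᵀ * T = 1 ∧ N.PosSemidef ∧ A = T * N := by
  obtain ⟨N, hN, hNN⟩ := (Matrix.posSemidef_transpose_mul_self A).exists_sqrt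
  obtain ⟨T, hT, hA⟩ := exists_orthogonal_of_gram_eq A N (by rw [hN.transpose_eq, hNN])
  exact ⟨T, N, hT, hN, hA⟩

/-! ### Norms that depend only on the Gram matrix -/

/-- A family of seminorms on the real matrices of all sizes which depend only on the Gram matrix
and are invariant under transposition. -/
structure GramNorm where
  toFun : ∀ {m n : Type} [Fintype m] [Fintype n], Matrix m n ℝ → ℝ
  add_le : ∀ {m n : Type} [Fintype m] [Fintype n] (A B : Matrix m n ℝ),
    toFun (A + B) ≤ toFun A + toFun B
  smul : ∀ {m n : Type} [Fintype m] [Fintype n] (c : ℝ) (A : Matrix m n ℝ),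
    toFun (c • A) = |c| * toFun A
  gram : ∀ {m p n : Type} [Fintype m] [Fintype p] [Fintype n] (A : Matrix m n ℝ)
    (B : Matrix p n ℝ), Aᵀ * A = Bᵀ * B → toFun A = toFun B
  transpose : ∀ {m n : Type} [Fintype m] [Fintype n] (A : Matrix m n ℝ), toFun Aᵀ = toFun A

namespace GramNorm

variable (f : GramNorm) {m n p q : Type} [Fintype m] [Fintype n] [Fintype p] [Fintype q]

theorem neg (A : Matrix m n ℝ) : f.toFun (-A) = f.toFun A := by
  simpa using f.smul (-1) A

theorem sub_le (A B : Matrix m n ℝ) : f.toFun (A - B) ≤ f.toFun A + f.toFun B := by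
  simpa [sub_eq_add_neg, f.neg B] using f.add_le A (-B)

theorem zero : f.toFun (0 : Matrix m n ℝ) = 0 := by
  simpa using f.smul 0 (0 : Matrix m n ℝ)

theorem nonneg (A : Matrix m n ℝ) : 0 ≤ f.toFun A := by
  have := f.sub_le A A
  rw [sub_self, f.zero] at this
  linarith

/-- With `K` the square root of `BᵀB - AᵀA`, the stacked matrices `[A; K]` and `[A; -K]` both have
the Gram matrix of `B`, and their mean `[A; 0]` has that of `A`. -/
theorem mono (A : Matrix m n ℝ) (B : Matrix p n ℝ) (h : (Bᵀ * B - Aᵀ * A).PosSemidef) :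
    f.toFun A ≤ f.toFun B := by
  classical
  obtain ⟨K, hK, hKK⟩ := h.exists_sqrt
  have h1 : f.toFun (Matrix.fromRows A K) = f.toFun B := f.gram _ _ (by
    rw [Matrix.transpose_fromRows, Matrix.fromCols_mul_fromRows, hK.transpose_eq, hKK]; abel)
  have h2 : f.toFun (Matrix.fromRows A (-K)) = f.toFun B := f.gram _ _ (by
    rw [Matrix.transpose_fromRows, Matrix.fromCols_mul_fromRows, Matrix.transpose_neg,
      hK.transpose_eq, neg_mul_neg, hKK]; abel)
  have h3 : f.toFun (Matrix.fromRows A K + Matrix.fromRows A (-K)) = f.toFun ((2 : ℝ) • A) := by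
    apply f.gram
    have : Matrix.fromRows A K + Matrix.fromRows A (-K)
        = Matrix.fromRows ((2 : ℝ) • A) (0 : Matrix n n ℝ) := by
      ext (i | i) j <;> simp [two_mul]
    rw [this, Matrix.transpose_fromRows, Matrix.fromCols_mul_fromRows]
    simp
  have h4 := f.add_le (Matrix.fromRows A K) (Matrix.fromRows A (-K))
  rw [h3, f.smul, h1, h2] at h4
  norm_num at h4
  linarith

/-- If `CᵀC ≤ c²`, then multiplication by `C` from the left increases the norm by at most `c`. -/
theorem mul_le_left [DecidableEq n] (C : Matrix m n ℝ) (B : Matrix n p ℝ) (c : ℝ) (hc : 0 ≤ c)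
    (h : (c ^ 2 • 1 - Cᵀ * C).PosSemidef) : f.toFun (C * B) ≤ c * f.toFun B := by
  have := f.mono (C * B) (c • B) (by
    have := h.conjTranspose_mul_mul_same B
    rw [Matrix.conjTranspose_eq_transpose_of_trivial] at this
    convert this using 1
    simp [Matrix.mul_sub, Matrix.sub_mul, Matrix.mul_assoc, smul_smul, sq])
  rwa [f.smul, abs_of_nonneg hc] at this

theorem mul_le_right [DecidableEq n] (B : Matrix p n ℝ) (C : Matrix n m ℝ) (c : ℝ) (hc : 0 ≤ c)
    (h : (c ^ 2 • 1 - C * Cᵀ).PosSemidef) : f.toFun (B * C) ≤ c * f.toFun B := by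
  rw [← f.transpose (B * C), ← f.transpose B, Matrix.transpose_mul]
  exact f.mul_le_left Cᵀ Bᵀ c hc (by simpa using h)

end GramNorm

/-! ### Matrices with orthonormal columns and their residuals -/

theorem posSemidef_one_sub_mul_transpose {m n : Type*} [Fintype m] [Fintype n] [DecidableEq m]
    [DecidableEq n] (V : Matrix m n ℝ) (hV : Vᵀ * V = 1) : (1 - V * Vᵀ).PosSemidef := by
  convert Matrix.posSemidef_transpose_mul_self (1 - V * Vᵀ) using 1
  have : V * Vᵀ * (V * Vᵀ) = V * Vᵀ := by
    rw [Matrix.mul_assoc, ← Matrix.mul_assoc Vᵀ, hV, Matrix.one_mul]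
  simp [Matrix.mul_sub, Matrix.sub_mul, this]

theorem posSemidef_one_sub_gram {m n p : Type*} [Fintype m] [Fintype n] [Fintype p]
    [DecidableEq m] [DecidableEq n] [DecidableEq p] (X : Matrix m n ℝ) (X' : Matrix m p ℝ)
    (hX : Xᵀ * X = 1) (hX' : X'ᵀ * X' = 1) : (1 - (Xᵀ * X')ᵀ * (Xᵀ * X')).PosSemidef := by
  have := (posSemidef_one_sub_mul_transpose X hX).conjTranspose_mul_mul_same X'
  rw [Matrix.conjTranspose_eq_transpose_of_trivial] at this
  convert this using 1
  simp [Matrix.mul_sub, Matrix.sub_mul, hX', Matrix.mul_assoc]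

/-- The residual of `X'` after projection onto the range of `X`. Since the singular values of `XᵀX'`
are cosines of the canonical angles, this Gram matrix has the squared sines as eigenvalues. -/
theorem gram_sub_proj {m n p : Type*} [Fintype m] [Fintype n] [Fintype p]
    [DecidableEq m] [DecidableEq n] [DecidableEq p] (X : Matrix m n ℝ) (X' : Matrix m p ℝ)
    (hX : Xᵀ * X = 1) (hX' : X'ᵀ * X' = 1) :
    (X' - X * (Xᵀ * X'))ᵀ * (X' - X * (Xᵀ * X')) = 1 - (Xᵀ * X')ᵀ * (Xᵀ * X') := by
  have h : Xᵀ * (X * (Xᵀ * X')) = Xᵀ * X' := by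
    rw [← Matrix.mul_assoc, hX, Matrix.one_mul]
  simp [Matrix.mul_sub, Matrix.sub_mul, hX', Matrix.mul_assoc, h]

/-- From `1 - N = ½((1 - N)² + (1 - N²))` one gets `N ≤ 1`; conjugating `1 - N` by the square root
of `N` gives the claim. -/
theorem Matrix.PosSemidef.sub_mul_self {n : Type*} [Fintype n] [DecidableEq n]
    {N : Matrix n n ℝ} (hN : N.PosSemidef) (h : (1 - N * N).PosSemidef) :
    (N - N * N).PosSemidef := by
  have h1 : (1 - N).PosSemidef := by
    have h2 := Matrix.posSemidef_transpose_mul_self (1 - N)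
    rw [Matrix.transpose_sub, Matrix.transpose_one, hN.transpose_eq] at h2
    convert (h2.add h).smul (show (0 : ℝ) ≤ 1 / 2 by norm_num) using 1
    ext i j
    simp [Matrix.mul_sub, Matrix.sub_mul]
    ring
  obtain ⟨K, hK, hKK⟩ := hN.exists_sqrt
  have h2 := h1.conjTranspose_mul_mul_same K
  rw [Matrix.conjTranspose_eq_transpose_of_trivial, hK.transpose_eq] at h2
  convert h2 using 1
  simp [Matrix.mul_sub, Matrix.sub_mul, ← hKK, Matrix.mul_assoc]

/-! ### Isometries, diagonal factors and the Sylvester equation -/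

namespace GramNorm

variable (f : GramNorm) {m n p q : Type} [Fintype m] [Fintype n] [Fintype p] [Fintype q]

theorem isometry_mul [DecidableEq n] (V : Matrix m n ℝ) (hV : Vᵀ * V = 1) (A : Matrix n p ℝ) :
    f.toFun (V * A) = f.toFun A := by
  apply f.gram
  rw [Matrix.transpose_mul, Matrix.mul_assoc, ← Matrix.mul_assoc Vᵀ, hV, Matrix.one_mul]

theorem mul_isometry_transpose [DecidableEq n] (V : Matrix m n ℝ) (hV : Vᵀ * V = 1) (A : Matrix p n ℝ) :
    f.toFun (A * Vᵀ) = f.toFun A := by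
  rw [← f.transpose, Matrix.transpose_mul, Matrix.transpose_transpose, f.isometry_mul V hV,
    f.transpose]

theorem isometry_transpose_mul_le [DecidableEq m] [DecidableEq n] (V : Matrix m n ℝ) (hV : Vᵀ * V = 1) (A : Matrix m p ℝ) :
    f.toFun (Vᵀ * A) ≤ f.toFun A := by
  have := f.mul_le_left Vᵀ A 1 zero_le_one
    (by simpa using posSemidef_one_sub_mul_transpose V hV)
  simpa using this

theorem mul_isometry_le [DecidableEq m] [DecidableEq n] (V : Matrix m n ℝ) (hV : Vᵀ * V = 1) (A : Matrix p m ℝ) :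
    f.toFun (A * V) ≤ f.toFun A := by
  have := f.isometry_transpose_mul_le V hV Aᵀ
  rwa [← Matrix.transpose_mul, f.transpose, f.transpose] at this

theorem le_diagonal_mul [DecidableEq m] (s : m → ℝ) (σ : ℝ) (hσ : 0 ≤ σ) (hs : ∀ i, σ ≤ s i) (A : Matrix m n ℝ) :
    σ * f.toFun A ≤ f.toFun (Matrix.diagonal s * A) := by
  have := f.mono (σ • A) (Matrix.diagonal s * A) (by
    have h : (Matrix.diagonal fun i => s i ^ 2 - σ ^ 2).PosSemidef :=
      Matrix.PosSemidef.diagonal fun i => by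
        have := pow_le_pow_left₀ hσ (hs i) 2
        simpa using this
    convert h.conjTranspose_mul_mul_same A using 1
    have h2 : (Matrix.diagonal fun i => s i ^ 2 - σ ^ 2)
        = Matrix.diagonal s * Matrix.diagonal s - σ ^ 2 • (1 : Matrix m m ℝ) := by
      ext i j
      by_cases hij : i = j <;> simp [hij, sq]
    rw [h2]
    simp [Matrix.mul_sub, Matrix.sub_mul, Matrix.mul_assoc, smul_smul, sq,
      Matrix.conjTranspose_eq_transpose_of_trivial, -Matrix.diagonal_mul_diagonal])
  rwa [f.smul, abs_of_nonneg hσ] at this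

theorem le_mul_diagonal [DecidableEq n] (s : n → ℝ) (σ : ℝ) (hσ : 0 ≤ σ) (hs : ∀ i, σ ≤ s i) (A : Matrix m n ℝ) :
    σ * f.toFun A ≤ f.toFun (A * Matrix.diagonal s) := by
  have := f.le_diagonal_mul s σ hσ hs Aᵀ
  rwa [f.transpose, ← f.transpose (_ * _), Matrix.transpose_mul, Matrix.transpose_transpose,
    Matrix.diagonal_transpose] at this

theorem diagonal_mul_le [DecidableEq m] (s : m → ℝ) (c : ℝ) (hc : 0 ≤ c) (hs : ∀ i, |s i| ≤ c)
    (A : Matrix m n ℝ) : f.toFun (Matrix.diagonal s * A) ≤ c * f.toFun A := by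
  refine f.mul_le_left _ A c hc ?_
  have h2 : c ^ 2 • (1 : Matrix m m ℝ) - (Matrix.diagonal s)ᵀ * Matrix.diagonal s
      = Matrix.diagonal fun i => c ^ 2 - s i ^ 2 := by
    ext i j
    by_cases hij : i = j <;> simp [hij, sq]
  rw [h2]
  exact Matrix.PosSemidef.diagonal fun i => by
    have := sq_le_sq' (neg_le_of_abs_le (hs i)) (le_of_abs_le (hs i))
    simpa using this

theorem mul_diagonal_le [DecidableEq n] (s : n → ℝ) (c : ℝ) (hc : 0 ≤ c) (hs : ∀ i, |s i| ≤ c)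
    (A : Matrix m n ℝ) : f.toFun (A * Matrix.diagonal s) ≤ c * f.toFun A := by
  have := f.diagonal_mul_le s c hc hs Aᵀ
  rwa [f.transpose, ← f.transpose (_ * _), Matrix.transpose_mul, Matrix.transpose_transpose,
    Matrix.diagonal_transpose] at this

/-- The norm bound for the Sylvester equation `S W + W T = R` with `S ≥ σ`, `T ≥ τ` diagonal. -/
theorem sylvester [DecidableEq m] [DecidableEq n] (s : m → ℝ) (t : n → ℝ) (σ τ : ℝ) (hs : ∀ i, σ ≤ s i) (ht : ∀ i, τ ≤ t i)
    (W : Matrix m n ℝ) :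
    (σ + τ) * f.toFun W ≤ f.toFun (Matrix.diagonal s * W + W * Matrix.diagonal t) := by
  obtain ⟨a, ha⟩ := (Set.finite_range s).bddAbove
  obtain ⟨b, hb⟩ := (Set.finite_range t).bddAbove
  -- `σ ≤ c` and `τ ≤ c` are required separately because `m` or `n` may be empty.
  obtain ⟨c, hc0, hc1, hc2, hc3, hc4⟩ : ∃ c : ℝ, 0 ≤ c ∧ a ≤ c ∧ b ≤ c ∧ σ ≤ c ∧ τ ≤ c :=
    ⟨|a| + |b| + |σ| + |τ|, by positivity,
      by linarith [le_abs_self a, abs_nonneg b, abs_nonneg σ, abs_nonneg τ],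
      by linarith [abs_nonneg a, le_abs_self b, abs_nonneg σ, abs_nonneg τ],
      by linarith [abs_nonneg a, abs_nonneg b, le_abs_self σ, abs_nonneg τ],
      by linarith [abs_nonneg a, abs_nonneg b, abs_nonneg σ, le_abs_self τ]⟩
  have hs' : ∀ i, |c - s i| ≤ c - σ := fun i => by
    have := ha (Set.mem_range_self i)
    rw [abs_of_nonneg (by linarith)]
    linarith [hs i]
  have ht' : ∀ i, |c - t i| ≤ c - τ := fun i => by
    have := hb (Set.mem_range_self i)
    rw [abs_of_nonneg (by linarith)]
    linarith [ht i]
  -- After the shift by `c`, the factors `c - S` and `c - T` have norms at most `c - σ` and `c - τ`,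
  -- so the triangle inequality leaves `σ + τ` on the left.
  have key : (2 * c) • W = Matrix.diagonal (fun i => c - s i) * W
      + W * Matrix.diagonal (fun i => c - t i)
      + (Matrix.diagonal s * W + W * Matrix.diagonal t) := by
    ext i j
    simp
    ring
  have h1 := f.add_le (Matrix.diagonal (fun i => c - s i) * W
      + W * Matrix.diagonal (fun i => c - t i)) (Matrix.diagonal s * W + W * Matrix.diagonal t)
  have h2 := f.add_le (Matrix.diagonal (fun i => c - s i) * W)
    (W * Matrix.diagonal (fun i => c - t i))
  have h3 := f.diagonal_mul_le _ _ (by linarith) hs' W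
  have h4 := f.mul_diagonal_le _ _ (by linarith) ht' W
  rw [← key, f.smul, abs_of_nonneg (by linarith)] at h1
  linarith

/-- With `XᵀX' = TN` the two Gram matrices are `1 - N²` and `T(1 - N²)Tᵀ`, hence orthogonally
similar. -/
theorem sub_proj_comm [DecidableEq m] [DecidableEq n] (X X' : Matrix n m ℝ) (hX : Xᵀ * X = 1) (hX' : X'ᵀ * X' = 1) :
    f.toFun (X' - X * (Xᵀ * X')) = f.toFun (X - X' * (X'ᵀ * X)) := by
  obtain ⟨T, N, hT, hN, hM⟩ := exists_polar (Xᵀ * X')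
  have hT' : T * Tᵀ = 1 := mul_eq_one_comm.1 hT
  rw [← f.mul_isometry_transpose T hT]
  apply f.gram
  rw [gram_sub_proj X' X hX' hX, Matrix.transpose_mul, Matrix.transpose_transpose,
    Matrix.mul_assoc, ← Matrix.mul_assoc _ _ Tᵀ, gram_sub_proj X X' hX hX']
  have hM' : X'ᵀ * X = N * Tᵀ := by
    rw [← hN.transpose_eq, ← Matrix.transpose_mul, ← hM]; simp
  have hTN : Tᵀ * (T * N) = N := by rw [← Matrix.mul_assoc, hT, Matrix.one_mul]
  rw [hM, hM']
  simp [Matrix.mul_sub, Matrix.sub_mul, Matrix.mul_assoc, hT', hN.transpose_eq, hTN]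

end GramNorm

/-- The orthogonal polar factor of `Xᵀ X'` aligns the orthonormal basis matrix `X` with `X'`. -/
theorem exists_alignment {m n : Type} [Fintype m] [Fintype n] [DecidableEq m] [DecidableEq n]
    (X X' : Matrix n m ℝ) (hX : Xᵀ * X = 1) (hX' : X'ᵀ * X' = 1) :
    ∃ T : Matrix m m ℝ, Tᵀ * T = 1 ∧
      ∀ f : GramNorm, f.toFun (X' - X * T) ≤ √2 * f.toFun (X' - X * (Xᵀ * X')) := by
  obtain ⟨T, N, hT, hN, hM⟩ := exists_polar (Xᵀ * X')
  refine ⟨T, hT, fun f => ?_⟩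
  have hTN : Tᵀ * (T * N) = N := by rw [← Matrix.mul_assoc, hT, Matrix.one_mul]
  have hM' : X'ᵀ * X = N * Tᵀ := by
    rw [← hN.transpose_eq, ← Matrix.transpose_mul, ← hM]; simp
  have hMM : (Xᵀ * X')ᵀ * (Xᵀ * X') = N * N := by
    rw [hM, Matrix.transpose_mul, hN.transpose_eq, Matrix.mul_assoc, hTN]
  have hpsd := posSemidef_one_sub_gram X X' hX hX'
  rw [hMM] at hpsd
  -- Source of `√2`: the Gram matrices are `2(1 - N)` and `2(1 - N²)`, and `N² ≤ N`.
  have h := f.mono (X' - X * T) (√2 • (X' - X * (Xᵀ * X'))) (by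
    have h1 : (√2 • (X' - X * (Xᵀ * X')))ᵀ * (√2 • (X' - X * (Xᵀ * X')))
        = (2 : ℝ) • (1 - N * N) := by
      rw [Matrix.transpose_smul, Matrix.smul_mul, Matrix.mul_smul, smul_smul,
        gram_sub_proj X X' hX hX', hMM, Real.mul_self_sqrt zero_le_two]
    have h2 : (X' - X * T)ᵀ * (X' - X * T) = (2 : ℝ) • (1 - N) := by
      have e1 : X'ᵀ * (X * T) = N := by
        rw [← Matrix.mul_assoc, hM', Matrix.mul_assoc, hT, Matrix.mul_one]
      have e2 : Tᵀ * Xᵀ * X' = N := by rw [Matrix.mul_assoc, hM, hTN]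
      have e3 : Tᵀ * Xᵀ * (X * T) = 1 := by
        rw [Matrix.mul_assoc, ← Matrix.mul_assoc Xᵀ, hX, Matrix.one_mul, hT]
      rw [Matrix.transpose_sub, Matrix.transpose_mul, Matrix.sub_mul, Matrix.mul_sub,
        Matrix.mul_sub, hX', e1, e2, e3, two_smul]
      abel
    rw [h1, h2, ← smul_sub, show (1 - N * N) - (1 - N) = N - N * N by abel]
    exact (hN.sub_mul_self hpsd).smul zero_le_two)
  rwa [f.smul, abs_of_nonneg (Real.sqrt_nonneg _)] at h

/-! ### Orthogonal matrices split into two column blocks -/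

/-- `[V₁, V₂]` is an orthogonal matrix. -/
structure IsFramePair {k κ₁ κ₂ : Type} [Fintype k] [Fintype κ₁] [Fintype κ₂] [DecidableEq k]
    [DecidableEq κ₁] [DecidableEq κ₂] (V₁ : Matrix k κ₁ ℝ) (V₂ : Matrix k κ₂ ℝ) : Prop where
  fst : V₁ᵀ * V₁ = 1
  snd : V₂ᵀ * V₂ = 1
  sum : V₁ * V₁ᵀ + V₂ * V₂ᵀ = 1

namespace IsFramePair

variable {k κ₁ κ₂ m : Type} [Fintype k] [Fintype κ₁] [Fintype κ₂] [DecidableEq k]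
  [DecidableEq κ₁] [DecidableEq κ₂] {V₁ A₁ : Matrix k κ₁ ℝ} {V₂ A₂ : Matrix k κ₂ ℝ}

theorem symm (h : IsFramePair V₁ V₂) : IsFramePair V₂ V₁ :=
  ⟨h.snd, h.fst, by rw [add_comm, h.sum]⟩

theorem rotate (h : IsFramePair V₁ V₂) (Z : Matrix k k ℝ) (hZ : Zᵀ * Z = 1) :
    IsFramePair (Z * V₁) (Z * V₂) where
  fst := by
    rw [Matrix.transpose_mul, Matrix.mul_assoc, ← Matrix.mul_assoc Zᵀ, hZ, Matrix.one_mul, h.fst]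
  snd := by
    rw [Matrix.transpose_mul, Matrix.mul_assoc, ← Matrix.mul_assoc Zᵀ, hZ, Matrix.one_mul, h.snd]
  sum := by
    have : Z * V₁ * (Z * V₁)ᵀ + Z * V₂ * (Z * V₂)ᵀ = Z * (V₁ * V₁ᵀ + V₂ * V₂ᵀ) * Zᵀ := by
      simp [Matrix.mul_add, Matrix.add_mul, Matrix.mul_assoc]
    rw [this, h.sum, Matrix.mul_one, mul_eq_one_comm.1 hZ]

theorem ortho (h : IsFramePair V₁ V₂) : V₁ᵀ * V₂ = 0 := by
  have h1 : V₁ᵀ * (V₁ * V₁ᵀ + V₂ * V₂ᵀ) * V₂ = V₁ᵀ * V₂ := by rw [h.sum, Matrix.mul_one]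
  have h2 : V₁ᵀ * (V₁ * V₁ᵀ + V₂ * V₂ᵀ) * V₂ = V₁ᵀ * V₂ + V₁ᵀ * V₂ := by
    rw [Matrix.mul_add, Matrix.add_mul, ← Matrix.mul_assoc, h.fst, Matrix.one_mul,
      ← Matrix.mul_assoc V₁ᵀ, Matrix.mul_assoc (V₁ᵀ * V₂), h.snd, Matrix.mul_one]
  rw [h1] at h2
  simpa using h2

theorem fst_mul (h : IsFramePair V₁ V₂) (A : Matrix κ₁ m ℝ) : V₁ᵀ * (V₁ * A) = A := by
  rw [← Matrix.mul_assoc, h.fst, Matrix.one_mul]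

theorem ortho_mul (h : IsFramePair V₁ V₂) (A : Matrix κ₂ m ℝ) : V₁ᵀ * (V₂ * A) = 0 := by
  rw [← Matrix.mul_assoc, h.ortho, Matrix.zero_mul]

theorem proj_compl (h : IsFramePair V₁ V₂) (A : Matrix k m ℝ) :
    A - V₁ * (V₁ᵀ * A) = V₂ * (V₂ᵀ * A) := by
  rw [sub_eq_iff_eq_add, ← Matrix.mul_assoc, ← Matrix.mul_assoc, ← Matrix.add_mul, add_comm,
    h.sum, Matrix.one_mul]

/-- The off-diagonal blocks of an orthogonal matrix `[V₁, V₂]ᵀ[A₁, A₂]` have equal norm: they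
represent the residual of `A₁` against `V₁` and of `V₁` against `A₁`. This lets one block be bounded
through either `σ` or `τ`. -/
theorem norm_cross (f : GramNorm) (h : IsFramePair V₁ V₂) (hA : IsFramePair A₁ A₂) :
    f.toFun (V₂ᵀ * A₁) = f.toFun (V₁ᵀ * A₂) := by
  rw [← f.isometry_mul V₂ h.snd, ← h.proj_compl, f.sub_proj_comm V₁ A₁ h.fst hA.fst,
    hA.proj_compl, f.isometry_mul A₂ hA.snd, ← f.transpose, Matrix.transpose_mul,
    Matrix.transpose_transpose]

theorem gram_split (h : IsFramePair V₁ V₂) (A : Matrix k m ℝ) :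
    Aᵀ * A = (V₁ᵀ * A)ᵀ * (V₁ᵀ * A) + (V₂ᵀ * A)ᵀ * (V₂ᵀ * A) := by
  have : (V₁ᵀ * A)ᵀ * (V₁ᵀ * A) + (V₂ᵀ * A)ᵀ * (V₂ᵀ * A)
      = Aᵀ * (V₁ * V₁ᵀ + V₂ * V₂ᵀ) * A := by
    simp [Matrix.mul_add, Matrix.add_mul, Matrix.mul_assoc]
  rw [this, h.sum, Matrix.mul_one]

theorem norm_split_le [Fintype m] (f : GramNorm) (h : IsFramePair V₁ V₂) (A : Matrix k m ℝ) :
    f.toFun A ≤ f.toFun (V₁ᵀ * A) + f.toFun (V₂ᵀ * A) := by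
  have h1 : A = V₁ * (V₁ᵀ * A) + V₂ * (V₂ᵀ * A) := by rw [← h.proj_compl]; abel
  calc f.toFun A = f.toFun (V₁ * (V₁ᵀ * A) + V₂ * (V₂ᵀ * A)) := by rw [← h1]
    _ ≤ _ := f.add_le _ _
    _ = _ := by rw [f.isometry_mul V₁ h.fst, f.isometry_mul V₂ h.snd]

theorem norm_split_right_le [Fintype m] (f : GramNorm) (h : IsFramePair V₁ V₂) (A : Matrix m k ℝ) :
    f.toFun A ≤ f.toFun (A * V₁) + f.toFun (A * V₂) := by
  have := h.norm_split_le f Aᵀ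
  rwa [f.transpose, ← Matrix.transpose_mul, ← Matrix.transpose_mul, f.transpose, f.transpose]
    at this

end IsFramePair

/-! ### Perturbation of subunitary polar factors -/

/-- Two positive semidefinite matrices `V₁ diag(s) V₁ᵀ`, `U₁ diag(t) U₁ᵀ` of the same rank in
spectral form, with lower bounds `σ`, `τ` for the positive eigenvalues, and an orthogonal `Z`. -/
structure SpectralPair {k κ₁ κ₂ : Type} [Fintype k] [Fintype κ₁] [Fintype κ₂] [DecidableEq k]
    [DecidableEq κ₁] [DecidableEq κ₂] (V₁ U₁ : Matrix k κ₁ ℝ) (V₂ U₂ : Matrix k κ₂ ℝ)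
    (s t : κ₁ → ℝ) (σ τ : ℝ) (Z : Matrix k k ℝ) : Prop where
  left : IsFramePair V₁ V₂
  right : IsFramePair U₁ U₂
  pos_left : 0 < σ
  pos_right : 0 < τ
  le_left : ∀ i, σ ≤ s i
  le_right : ∀ i, τ ≤ t i
  orth : Zᵀ * Z = 1

namespace SpectralPair

variable {k κ₁ κ₂ : Type} [Fintype k] [Fintype κ₁] [Fintype κ₂] [DecidableEq k]
    [DecidableEq κ₁] [DecidableEq κ₂] {V₁ U₁ : Matrix k κ₁ ℝ} {V₂ U₂ : Matrix k κ₂ ℝ}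
    {s t : κ₁ → ℝ} {σ τ : ℝ} {Z : Matrix k k ℝ}

/-- The difference `V₁ V₁ᵀ - Z U₁ U₁ᵀ` of the subunitary polar factors. -/
abbrev polarDiff (V₁ U₁ : Matrix k κ₁ ℝ) (Z : Matrix k k ℝ) : Matrix k k ℝ :=
  V₁ * V₁ᵀ - Z * (U₁ * U₁ᵀ)

/-- The difference of `V₁ diag(s) V₁ᵀ` and `Z U₁ diag(t) U₁ᵀ`. -/
abbrev diff (V₁ U₁ : Matrix k κ₁ ℝ) (s t : κ₁ → ℝ) (Z : Matrix k k ℝ) : Matrix k k ℝ :=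
  V₁ * Matrix.diagonal s * V₁ᵀ - Z * (U₁ * Matrix.diagonal t * U₁ᵀ)

theorem block_two_two (h : SpectralPair V₁ U₁ V₂ U₂ s t σ τ Z) :
    V₂ᵀ * polarDiff V₁ U₁ Z * U₂ = 0 := by
  simp [polarDiff, Matrix.mul_sub, Matrix.mul_assoc, h.left.symm.ortho_mul,
    h.right.ortho]

/-- With `E` the value of `diff`, the block `B` solves `diag(s) B + B diag(t) = V₁ᵀEU₁ -
(U₁ᵀZᵀEV₁)ᵀ`. -/
theorem norm_block_one_one (f : GramNorm) (h : SpectralPair V₁ U₁ V₂ U₂ s t σ τ Z) :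
    (σ + τ) * f.toFun (V₁ᵀ * polarDiff V₁ U₁ Z * U₁) ≤
      f.toFun (V₁ᵀ * diff V₁ U₁ s t Z * U₁) + f.toFun (U₁ᵀ * (Zᵀ * diff V₁ U₁ s t Z) * V₁) := by
  have hZ : ∀ A : Matrix k κ₁ ℝ, Zᵀ * (Z * A) = A := fun A => by
    rw [← Matrix.mul_assoc, h.orth, Matrix.one_mul]
  refine (f.sylvester s t σ τ h.le_left h.le_right _).trans ?_
  rw [← f.transpose (U₁ᵀ * (Zᵀ * diff V₁ U₁ s t Z) * V₁)]
  refine le_trans (le_of_eq ?_) (f.sub_le _ _)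
  congr 1
  simp [polarDiff, diff, Matrix.mul_sub, Matrix.sub_mul, Matrix.mul_assoc, h.left.fst_mul,
    h.right.fst, h.left.fst, h.right.fst_mul, hZ]
  abel

/-- The block is `V₁ᵀU₂`, which appears in `E` multiplied by `diag(s)`. By `norm_cross` it has the
norm of `U₁ᵀV₂`, which appears in `ZᵀE` multiplied by `diag(t)`. -/
theorem norm_block_one_two (f : GramNorm) (h : SpectralPair V₁ U₁ V₂ U₂ s t σ τ Z) :
    σ * f.toFun (V₁ᵀ * polarDiff V₁ U₁ Z * U₂) ≤ f.toFun (V₁ᵀ * diff V₁ U₁ s t Z * U₂) ∧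
    τ * f.toFun (V₁ᵀ * polarDiff V₁ U₁ Z * U₂) ≤
      f.toFun (U₁ᵀ * (Zᵀ * diff V₁ U₁ s t Z) * V₂) := by
  have hZ : ∀ A : Matrix k κ₂ ℝ, Zᵀ * (Z * A) = A := fun A => by
    rw [← Matrix.mul_assoc, h.orth, Matrix.one_mul]
  have h1 : V₁ᵀ * polarDiff V₁ U₁ Z * U₂ = V₁ᵀ * U₂ := by
    simp [polarDiff, Matrix.mul_sub, Matrix.sub_mul, Matrix.mul_assoc, h.left.fst_mul,
      h.right.ortho]
  rw [h1]
  constructor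
  · refine (f.le_diagonal_mul s σ h.pos_left.le h.le_left _).trans (le_of_eq ?_)
    congr 1
    simp [diff, Matrix.mul_sub, Matrix.sub_mul, Matrix.mul_assoc, h.left.fst_mul, h.right.ortho]
  · rw [← h.left.norm_cross f h.right, ← f.transpose, Matrix.transpose_mul,
      Matrix.transpose_transpose]
    refine (f.le_diagonal_mul t τ h.pos_right.le h.le_right _).trans (le_of_eq ?_)
    rw [← f.neg]
    congr 1
    simp [diff, Matrix.mul_sub, Matrix.sub_mul, Matrix.mul_assoc, h.left.ortho,
      h.right.fst_mul, hZ]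

/-- As for the other off-diagonal block, now with `V₂ᵀZU₁` and the rotated pair `[ZU₁, ZU₂]`. -/
theorem norm_block_two_one (f : GramNorm) (h : SpectralPair V₁ U₁ V₂ U₂ s t σ τ Z) :
    τ * f.toFun (V₂ᵀ * polarDiff V₁ U₁ Z * U₁) ≤ f.toFun (V₂ᵀ * diff V₁ U₁ s t Z * U₁) ∧
    σ * f.toFun (V₂ᵀ * polarDiff V₁ U₁ Z * U₁) ≤
      f.toFun (U₂ᵀ * (Zᵀ * diff V₁ U₁ s t Z) * V₁) := by
  have hZ : ∀ A : Matrix k κ₁ ℝ, Zᵀ * (Z * A) = A := fun A => by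
    rw [← Matrix.mul_assoc, h.orth, Matrix.one_mul]
  have h1 : V₂ᵀ * polarDiff V₁ U₁ Z * U₁ = -(V₂ᵀ * (Z * U₁)) := by
    simp [polarDiff, Matrix.mul_sub, Matrix.mul_assoc, h.left.symm.ortho_mul,
      h.right.fst]
  rw [h1, f.neg]
  constructor
  · refine (f.le_mul_diagonal t τ h.pos_right.le h.le_right _).trans (le_of_eq ?_)
    rw [← f.neg]
    congr 1
    simp [diff, Matrix.mul_sub, Matrix.mul_assoc, h.left.symm.ortho_mul,
      h.right.fst]
  · rw [h.left.norm_cross f (h.right.rotate Z h.orth), ← f.transpose, Matrix.transpose_mul,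
      Matrix.transpose_transpose, Matrix.transpose_mul]
    refine (f.le_mul_diagonal s σ h.pos_left.le h.le_left _).trans (le_of_eq ?_)
    congr 1
    simp [diff, Matrix.mul_sub, Matrix.sub_mul, Matrix.mul_assoc, h.left.fst,
      h.right.symm.ortho_mul, hZ]

theorem norm_block_le (f : GramNorm) {κ κ' : Type} [Fintype κ] [Fintype κ'] [DecidableEq κ]
    [DecidableEq κ'] {V : Matrix k κ ℝ} {U : Matrix k κ' ℝ} (hV : Vᵀ * V = 1) (hU : Uᵀ * U = 1)
    (A : Matrix k k ℝ) : f.toFun (Vᵀ * A * U) ≤ f.toFun A :=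
  (f.mul_isometry_le U hU _).trans (f.isometry_transpose_mul_le V hV A)

theorem norm_transpose_mul (f : GramNorm) (hZ : Zᵀ * Z = 1) (A : Matrix k k ℝ) :
    f.toFun (Zᵀ * A) = f.toFun A :=
  f.isometry_mul Zᵀ (by rw [Matrix.transpose_transpose, mul_eq_one_comm.1 hZ]) A

theorem norm_blocks_le (f : GramNorm) (h : SpectralPair V₁ U₁ V₂ U₂ s t σ τ Z) {ε : ℝ}
    (hε : f.toFun (diff V₁ U₁ s t Z) ≤ ε) :
    f.toFun (V₁ᵀ * polarDiff V₁ U₁ Z * U₁) ≤ 2 * ε / (σ + τ) ∧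
    f.toFun (V₁ᵀ * polarDiff V₁ U₁ Z * U₂) ≤ ε / max σ τ ∧
    f.toFun (V₂ᵀ * polarDiff V₁ U₁ Z * U₁) ≤ ε / max σ τ := by
  have hσ := h.pos_left
  have hτ := h.pos_right
  have hε' : f.toFun (Zᵀ * diff V₁ U₁ s t Z) ≤ ε := by rwa [norm_transpose_mul f h.orth]
  have hmax : ∀ a : ℝ, σ * a ≤ ε → τ * a ≤ ε → a ≤ ε / max σ τ := fun a h1 h2 => by
    rw [le_div_iff₀ (lt_max_of_lt_left hσ), mul_comm]
    rcases max_choice σ τ with h | h <;> rw [h] <;> assumption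
  have h11 := h.norm_block_one_one f
  have h12 := h.norm_block_one_two f
  have h21 := h.norm_block_two_one f
  refine ⟨?_, hmax _ (h12.1.trans ((norm_block_le f h.left.fst h.right.snd _).trans hε))
    (h12.2.trans ((norm_block_le f h.right.fst h.left.snd _).trans hε')),
    hmax _ (h21.2.trans ((norm_block_le f h.right.snd h.left.fst _).trans hε'))
    (h21.1.trans ((norm_block_le f h.left.snd h.right.fst _).trans hε))⟩
  rw [le_div_iff₀ (by positivity)]
  have h1 := norm_block_le f h.left.fst h.right.fst (diff V₁ U₁ s t Z)
  have h2 := norm_block_le f h.right.fst h.left.fst (Zᵀ * diff V₁ U₁ s t Z)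
  linarith

theorem norm_polarDiff_le (f : GramNorm) (h : SpectralPair V₁ U₁ V₂ U₂ s t σ τ Z) {ε : ℝ}
    (hε : f.toFun (diff V₁ U₁ s t Z) ≤ ε) :
    f.toFun (polarDiff V₁ U₁ Z) ≤ 2 * ε / (σ + τ) + 2 * (ε / max σ τ) := by
  obtain ⟨h11, h12, h21⟩ := h.norm_blocks_le f hε
  have h1 := h.left.norm_split_le f (polarDiff V₁ U₁ Z)
  have h2 := h.right.norm_split_right_le f (V₁ᵀ * polarDiff V₁ U₁ Z)
  have h3 := h.right.norm_split_right_le f (V₂ᵀ * polarDiff V₁ U₁ Z)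
  rw [h.block_two_two, f.zero] at h3
  linarith

/-- `W` rotates the orthogonal complement of `V₁` such that `[V₁, V₂ W]` is close to `Z`. -/
theorem exists_rotation (h : SpectralPair V₁ U₁ V₂ U₂ s t σ τ Z) :
    ∃ W : Matrix κ₂ κ₂ ℝ, Wᵀ * W = 1 ∧ ∀ (f : GramNorm) (ε : ℝ),
      f.toFun (diff V₁ U₁ s t Z) ≤ ε →
      f.toFun (V₂ * W * V₂ᵀ - Z * (U₂ * U₂ᵀ)) ≤ 2 * √2 * (ε / max σ τ) := by
  -- `T` aligns `V₂` with `ZU₂` and `R` aligns `U₂` with `V₂`; `W = TR` makes the error telescope.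
  -- Each alignment costs `√2` times an off-diagonal block of `polarDiff`.
  obtain ⟨T, hT, hT'⟩ := exists_alignment V₂ (Z * U₂) h.left.snd (h.right.rotate Z h.orth).snd
  obtain ⟨R, hR, hR'⟩ := exists_alignment U₂ V₂ h.right.snd h.left.snd
  refine ⟨T * R, ?_, fun f ε hε => ?_⟩
  · rw [Matrix.transpose_mul, Matrix.mul_assoc, ← Matrix.mul_assoc Tᵀ, hT, Matrix.one_mul, hR]
  obtain ⟨-, h12, h21⟩ := h.norm_blocks_le f hε
  have e1 : V₂ * (T * R) * V₂ᵀ - Z * (U₂ * U₂ᵀ)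
      = V₂ * (T * (R * (V₂ᵀ - Rᵀ * U₂ᵀ))) - (Z * U₂ - V₂ * T) * U₂ᵀ := by
    have : R * (Rᵀ * U₂ᵀ) = U₂ᵀ := by
      rw [← Matrix.mul_assoc, mul_eq_one_comm.1 hR, Matrix.one_mul]
    simp [Matrix.mul_sub, Matrix.sub_mul, Matrix.mul_assoc, this]
  have e2 : f.toFun (V₂ * (T * (R * (V₂ᵀ - Rᵀ * U₂ᵀ)))) = f.toFun (V₂ - U₂ * R) := by
    rw [f.isometry_mul _ h.left.snd, f.isometry_mul _ hT, f.isometry_mul _ hR, ← f.transpose]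
    simp
  have e3 : f.toFun (V₂ - U₂ * (U₂ᵀ * V₂)) = f.toFun (V₁ᵀ * polarDiff V₁ U₁ Z * U₂) := by
    rw [h.right.symm.proj_compl, f.isometry_mul _ h.right.fst, ← f.transpose (U₁ᵀ * V₂),
      Matrix.transpose_mul, Matrix.transpose_transpose, h.left.norm_cross f h.right]
    congr 1
    simp [polarDiff, Matrix.mul_sub, Matrix.sub_mul, Matrix.mul_assoc, h.left.fst_mul,
      h.right.ortho]
  have e4 : f.toFun (Z * U₂ - V₂ * (V₂ᵀ * (Z * U₂)))
      = f.toFun (V₂ᵀ * polarDiff V₁ U₁ Z * U₁) := by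
    rw [h.left.symm.proj_compl, f.isometry_mul _ h.left.fst,
      ← h.left.norm_cross f (h.right.rotate Z h.orth), ← f.neg]
    congr 1
    simp [polarDiff, Matrix.mul_sub, Matrix.mul_assoc, h.left.symm.ortho_mul,
      h.right.fst]
  have h1 := f.sub_le (V₂ * (T * (R * (V₂ᵀ - Rᵀ * U₂ᵀ)))) ((Z * U₂ - V₂ * T) * U₂ᵀ)
  rw [← e1, e2, f.mul_isometry_transpose _ h.right.snd] at h1
  have h2 := hT' f
  have h3 := hR' f
  rw [e4] at h2
  rw [e3] at h3
  have h4 := mul_le_mul_of_nonneg_left h12 (Real.sqrt_nonneg 2)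
  have h5 := mul_le_mul_of_nonneg_left h21 (Real.sqrt_nonneg 2)
  linarith

end SpectralPair

/-! ### Unitarily invariant norms depend only on the Gram matrix -/

namespace UnitarilyInvariantNorm

variable (ν : UnitarilyInvariantNorm)

/-- Permutation matrices are orthogonal. This makes the extension to arbitrary index types
independent of the enumeration. -/
theorem submatrix_perm {m n : ℕ} (A : Matrix (Fin m) (Fin n) ℝ) (σ : Equiv.Perm (Fin m))
    (τ : Equiv.Perm (Fin n)) : ν.toFun (A.submatrix σ τ) = ν.toFun A := by
  have h : ∀ {l : ℕ} (π : Equiv.Perm (Fin l)),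
      (1 : Matrix (Fin l) (Fin l) ℝ).submatrix π id ∈ Matrix.orthogonalGroup (Fin l) ℝ := by
    intro l π
    rw [Matrix.mem_orthogonalGroup_iff]
    ext i j
    simp [Matrix.mul_apply, Matrix.one_apply]
  have h' : (1 : Matrix (Fin n) (Fin n) ℝ).submatrix id τ
      ∈ Matrix.orthogonalGroup (Fin n) ℝ := by
    have := Unitary.star_mem (h τ)
    convert this using 1
    ext i j
    simp [Matrix.one_apply, eq_comm]
  rw [← ν.invariant A _ (h σ) _ h']
  congr 1
  ext i j
  simp [Matrix.mul_apply, Matrix.one_apply]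

/-- A dimension-free unitarily invariant norm on matrices with arbitrary finite index types. -/
noncomputable def extend {m n : Type} [Fintype m] [Fintype n] (A : Matrix m n ℝ) : ℝ :=
  ν.toFun (A.submatrix (Fintype.equivFin m).symm (Fintype.equivFin n).symm)

variable {m n p q : Type} [Fintype m] [Fintype n] [Fintype p] [Fintype q]

theorem extend_eq {a b : ℕ} (A : Matrix m n ℝ) (e : Fin a ≃ m) (e' : Fin b ≃ n) :
    ν.extend A = ν.toFun (A.submatrix e e') := by
  obtain rfl : a = Fintype.card m := by simpa using Fintype.card_congr e
  obtain rfl : b = Fintype.card n := by simpa using Fintype.card_congr e'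
  rw [← ν.submatrix_perm _ ((Fintype.equivFin m).symm.trans e.symm)
    ((Fintype.equivFin n).symm.trans e'.symm), extend]
  congr 1
  ext i j
  simp

theorem extend_fin {a b : ℕ} (A : Matrix (Fin a) (Fin b) ℝ) : ν.extend A = ν.toFun A := by
  simpa using ν.extend_eq A (Equiv.refl _) (Equiv.refl _)

theorem extend_submatrix (A : Matrix m n ℝ) (e : p ≃ m) (e' : q ≃ n) :
    ν.extend (A.submatrix e e') = ν.extend A := by
  rw [extend, Matrix.submatrix_submatrix]
  exact (ν.extend_eq A ((Fintype.equivFin p).symm.trans e)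
    ((Fintype.equivFin q).symm.trans e')).symm

theorem extend_border (A : Matrix m n ℝ) :
    ν.extend (Matrix.fromBlocks A 0 0 (0 : Matrix p q ℝ)) = ν.extend A := by
  rw [ν.extend_eq _ (finSumFinEquiv.symm.trans
    ((Fintype.equivFin m).symm.sumCongr (Fintype.equivFin p).symm)) (finSumFinEquiv.symm.trans
    ((Fintype.equivFin n).symm.sumCongr (Fintype.equivFin q).symm)), extend,
    ← ν.border (Fintype.card p) (Fintype.card q)
      (A.submatrix (Fintype.equivFin m).symm (Fintype.equivFin n).symm)]
  refine congrArg ν.toFun ?_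
  ext i j
  rcases h : finSumFinEquiv.symm i with i' | i' <;> rcases h' : finSumFinEquiv.symm j with j' | j'
    <;> simp [h, h']

theorem mem_orthogonalGroup_submatrix [DecidableEq m] (U : Matrix m m ℝ) (hU : Uᵀ * U = 1)
    {a : ℕ} (e : Fin a ≃ m) : U.submatrix e e ∈ Matrix.orthogonalGroup (Fin a) ℝ := by
  rw [Matrix.mem_orthogonalGroup_iff', Matrix.transpose_submatrix, Matrix.submatrix_mul_equiv, hU, Matrix.submatrix_one_equiv]

theorem extend_mul_left [DecidableEq m] (U : Matrix m m ℝ) (hU : Uᵀ * U = 1) (A : Matrix m n ℝ) :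
    ν.extend (U * A) = ν.extend A := by
  have := ν.invariant (A.submatrix (Fintype.equivFin m).symm (Fintype.equivFin n).symm) _
    (mem_orthogonalGroup_submatrix U hU (Fintype.equivFin m).symm) 1 (one_mem _)
  rwa [Matrix.mul_one, Matrix.submatrix_mul_equiv] at this

theorem extend_mul_right [DecidableEq n] (A : Matrix m n ℝ) (U : Matrix n n ℝ) (hU : Uᵀ * U = 1) :
    ν.extend (A * U) = ν.extend A := by
  have := ν.invariant (A.submatrix (Fintype.equivFin m).symm (Fintype.equivFin n).symm)
    1 (one_mem _) _ (mem_orthogonalGroup_submatrix U hU (Fintype.equivFin n).symm)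
  rwa [Matrix.one_mul, Matrix.submatrix_mul_equiv] at this

/-- Zero rows bring both matrices to a common size, `[A; 0]` and `[0; B]`, where equal Gram matrices
give an orthogonal factor. Bordering by `Empty` columns adds none. -/
theorem extend_gram (A : Matrix m n ℝ) (B : Matrix p n ℝ) (h : Aᵀ * A = Bᵀ * B) :
    ν.extend A = ν.extend B := by
  classical
  rw [← ν.extend_border (p := p) (q := Empty) A, ← ν.extend_border (p := m) (q := Empty) B,
    ← ν.extend_submatrix (Matrix.fromBlocks B 0 0 (0 : Matrix m Empty ℝ)) (Equiv.sumComm m p)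
      (Equiv.refl _)]
  obtain ⟨U, hU, hA⟩ := exists_orthogonal_of_gram_eq
    (Matrix.fromBlocks A 0 0 (0 : Matrix p Empty ℝ))
    (Matrix.fromBlocks 0 0 B (0 : Matrix p Empty ℝ) : Matrix (m ⊕ p) (n ⊕ Empty) ℝ)
    (by simp [Matrix.fromBlocks_transpose, Matrix.fromBlocks_multiply, h])
  rw [hA, ν.extend_mul_left U hU]
  congr 1
  ext (i | i) (j | j) <;> simp

theorem extend_gram_right (A : Matrix m n ℝ) (B : Matrix m p ℝ) (h : A * Aᵀ = B * Bᵀ) :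
    ν.extend A = ν.extend B := by
  classical
  rw [← ν.extend_border (p := Empty) (q := p) A, ← ν.extend_border (p := Empty) (q := n) B,
    ← ν.extend_submatrix (Matrix.fromBlocks B 0 0 (0 : Matrix Empty n ℝ)) (Equiv.refl _)
      (Equiv.sumComm n p)]
  obtain ⟨U, hU, hA⟩ := exists_orthogonal_of_gram_eq
    (Matrix.fromBlocks A 0 0 (0 : Matrix Empty p ℝ))ᵀ
    (Matrix.fromBlocks 0 B 0 (0 : Matrix Empty p ℝ) : Matrix (m ⊕ Empty) (n ⊕ p) ℝ)ᵀ
    (by simp [Matrix.fromBlocks_transpose, Matrix.fromBlocks_multiply, h])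
  rw [← Matrix.transpose_transpose (Matrix.fromBlocks A 0 0 0), hA, Matrix.transpose_mul,
    ν.extend_mul_right _ Uᵀ (by rw [Matrix.transpose_transpose, mul_eq_one_comm.1 hU])]
  congr 1
  ext (i | i) (j | j) <;> simp

/-- Both are compared with the square root `K` of `AᵀA`: `A` through its left Gram matrix, `Aᵀ`
through its right one. -/
theorem extend_transpose (A : Matrix m n ℝ) : ν.extend Aᵀ = ν.extend A := by
  classical
  obtain ⟨K, hK, hKK⟩ := (Matrix.posSemidef_transpose_mul_self A).exists_sqrt
  rw [ν.extend_gram A K (by rw [hK.transpose_eq, hKK]),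
    ν.extend_gram_right Aᵀ K (by rw [hK.transpose_eq, hKK, Matrix.transpose_transpose])]

noncomputable def toGramNorm : GramNorm where
  toFun := ν.extend
  add_le _ _ := ν.add_le _ _
  smul _ _ := ν.smul _ _
  gram := ν.extend_gram
  transpose := ν.extend_transpose

end UnitarilyInvariantNorm

/-! ### The Frobenius norm -/

section Frobenius

open scoped Matrix.Norms.Frobenius

theorem frobenius_norm_sq {m n : Type*} [Fintype m] [Fintype n] (A : Matrix m n ℝ) :
    ‖A‖ ^ 2 = (Aᵀ * A).trace := by
  rw [Matrix.frobenius_norm_def, ← Real.sqrt_eq_rpow,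
    Real.sq_sqrt (by positivity), Finset.sum_comm]
  simp [Matrix.trace, Matrix.mul_apply, sq]

noncomputable def frobeniusGramNorm : GramNorm where
  toFun A := ‖A‖
  add_le := norm_add_le
  smul c A := by rw [norm_smul, Real.norm_eq_abs]
  gram A B h := by
    rw [← sq_eq_sq₀ (norm_nonneg _) (norm_nonneg _), frobenius_norm_sq, h, frobenius_norm_sq]
  transpose := Matrix.frobenius_norm_transpose

theorem frobeniusGramNorm_apply {m n : ℕ} (A : Matrix (Fin m) (Fin n) ℝ) :
    frobeniusGramNorm.toFun A = frobeniusNorm A := rfl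

variable {k κ₁ κ₂ m : Type} [Fintype k] [Fintype κ₁] [Fintype κ₂] [Fintype m] [DecidableEq k]
  [DecidableEq κ₁] [DecidableEq κ₂] {V₁ U₁ : Matrix k κ₁ ℝ} {V₂ U₂ : Matrix k κ₂ ℝ}

theorem IsFramePair.frobenius_split (h : IsFramePair V₁ V₂) (A : Matrix k m ℝ) :
    frobeniusGramNorm.toFun A ^ 2
      = frobeniusGramNorm.toFun (V₁ᵀ * A) ^ 2 + frobeniusGramNorm.toFun (V₂ᵀ * A) ^ 2 := by
  change ‖A‖ ^ 2 = ‖V₁ᵀ * A‖ ^ 2 + ‖V₂ᵀ * A‖ ^ 2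
  rw [frobenius_norm_sq, frobenius_norm_sq, frobenius_norm_sq, ← Matrix.trace_add,
    ← h.gram_split]

theorem IsFramePair.frobenius_split_right (h : IsFramePair V₁ V₂) (A : Matrix m k ℝ) :
    frobeniusGramNorm.toFun A ^ 2
      = frobeniusGramNorm.toFun (A * V₁) ^ 2 + frobeniusGramNorm.toFun (A * V₂) ^ 2 := by
  have := h.frobenius_split Aᵀ
  rwa [← Matrix.transpose_mul, ← Matrix.transpose_mul, GramNorm.transpose, GramNorm.transpose,
    GramNorm.transpose] at this

theorem IsFramePair.frobenius_blocks (h : IsFramePair V₁ V₂) (h' : IsFramePair U₁ U₂)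
    (A : Matrix k k ℝ) : frobeniusGramNorm.toFun A ^ 2
      = frobeniusGramNorm.toFun (V₁ᵀ * A * U₁) ^ 2 + frobeniusGramNorm.toFun (V₁ᵀ * A * U₂) ^ 2
      + (frobeniusGramNorm.toFun (V₂ᵀ * A * U₁) ^ 2
      + frobeniusGramNorm.toFun (V₂ᵀ * A * U₂) ^ 2) := by
  rw [h.frobenius_split, h'.frobenius_split_right (V₁ᵀ * A), h'.frobenius_split_right (V₂ᵀ * A)]

end Frobenius

/-- Minkowski's inequality in `ℝ³`, in the form needed to combine three block bounds: `(a + b)² ≤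
2a² + 2b²`. -/
theorem minkowski_three {c x₁ x₂ x₃ a₁ a₂ a₃ b₁ b₂ b₃ x e : ℝ} (hc : 0 ≤ c) (he : 0 ≤ e)
    (hx₁ : 0 ≤ x₁) (hx₂ : 0 ≤ x₂) (hx₃ : 0 ≤ x₃)
    (h₁ : c * x₁ ≤ a₁ + b₁) (h₂ : c * x₂ ≤ a₂ + b₂) (h₃ : c * x₃ ≤ a₃ + b₃)
    (hx : x ^ 2 = x₁ ^ 2 + x₂ ^ 2 + x₃ ^ 2)
    (ha : a₁ ^ 2 + a₂ ^ 2 + a₃ ^ 2 ≤ e ^ 2) (hb : b₁ ^ 2 + b₂ ^ 2 + b₃ ^ 2 ≤ e ^ 2) :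
    c * x ≤ 2 * e := by
  refine le_of_sq_le_sq ?_ (by positivity)
  have q₁ := pow_le_pow_left₀ (mul_nonneg hc hx₁) h₁ 2
  have q₂ := pow_le_pow_left₀ (mul_nonneg hc hx₂) h₂ 2
  have q₃ := pow_le_pow_left₀ (mul_nonneg hc hx₃) h₃ 2
  have : (c * x) ^ 2 = (c * x₁) ^ 2 + (c * x₂) ^ 2 + (c * x₃) ^ 2 := by
    rw [mul_pow, hx]; ring
  rw [this]
  linarith [sq_nonneg (a₁ - b₁), sq_nonneg (a₂ - b₂), sq_nonneg (a₃ - b₃)]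

/-- Adding the `σ` and `τ` bounds of each off-diagonal block gives all three blocks the same factor
`σ + τ`, with one block of `E` and one of `ZᵀE` on the right. Pythagoras then reassembles them
without a `max` term. -/
theorem SpectralPair.frobenius_polarDiff_le {k κ₁ κ₂ : Type} [Fintype k] [Fintype κ₁] [Fintype κ₂]
    [DecidableEq k] [DecidableEq κ₁] [DecidableEq κ₂] {V₁ U₁ : Matrix k κ₁ ℝ}
    {V₂ U₂ : Matrix k κ₂ ℝ} {s t : κ₁ → ℝ} {σ τ : ℝ} {Z : Matrix k k ℝ}
    (h : SpectralPair V₁ U₁ V₂ U₂ s t σ τ Z) {ε : ℝ}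
    (hε : frobeniusGramNorm.toFun (diff V₁ U₁ s t Z) ≤ ε) :
    frobeniusGramNorm.toFun (polarDiff V₁ U₁ Z) ≤ 2 * ε / (σ + τ) := by
  have hσ := h.pos_left
  have hτ := h.pos_right
  set f := frobeniusGramNorm
  have hε' : f.toFun (Zᵀ * diff V₁ U₁ s t Z) ≤ ε := by rwa [norm_transpose_mul f h.orth]
  have hε0 : 0 ≤ ε := (f.nonneg _).trans hε
  have hF := h.left.frobenius_blocks h.right (polarDiff V₁ U₁ Z)
  rw [h.block_two_two, GramNorm.zero] at hF
  have hE := h.left.frobenius_blocks h.right (diff V₁ U₁ s t Z)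
  have hE' := h.right.frobenius_blocks h.left (Zᵀ * diff V₁ U₁ s t Z)
  obtain ⟨h12, h12'⟩ := h.norm_block_one_two f
  obtain ⟨h21, h21'⟩ := h.norm_block_two_one f
  have h12 := add_le_add h12 h12'
  have h21 := add_le_add h21' h21
  rw [← add_mul] at h12 h21
  rw [le_div_iff₀ (by positivity), mul_comm]
  have hEε := pow_le_pow_left₀ (f.nonneg _) hε 2
  have hEε' := pow_le_pow_left₀ (f.nonneg _) hε' 2
  refine minkowski_three (by positivity) hε0 (f.nonneg _) (f.nonneg _) (f.nonneg _)
    (h.norm_block_one_one f) h12 (h21.trans_eq (add_comm _ _)) (hF.trans (by ring)) ?_ ?_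
  · linarith [sq_nonneg (f.toFun (V₂ᵀ * diff V₁ U₁ s t Z * U₂))]
  · linarith [sq_nonneg (f.toFun (U₂ᵀ * (Zᵀ * diff V₁ U₁ s t Z) * V₂))]

/-! ### The spectral norm -/

section Spectral

open scoped Matrix.Norms.L2Operator

theorem l2_opNorm_sq {m n : Type*} [Fintype m] [Fintype n] [DecidableEq n] (A : Matrix m n ℝ) :
    ‖A‖ ^ 2 = ‖Aᵀ * A‖ := by
  rw [← Matrix.conjTranspose_eq_transpose_of_trivial, Matrix.l2_opNorm_conjTranspose_mul_self, sq]

open scoped Classical in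
noncomputable def spectralGramNorm : GramNorm where
  toFun A := ‖A‖
  add_le := norm_add_le
  smul c A := by rw [norm_smul, Real.norm_eq_abs]
  gram A B h := by
    rw [← sq_eq_sq₀ (norm_nonneg _) (norm_nonneg _), l2_opNorm_sq, h, l2_opNorm_sq]
  transpose A := by
    rw [← Matrix.conjTranspose_eq_transpose_of_trivial, Matrix.l2_opNorm_conjTranspose]

theorem spectralGramNorm_apply {m n : ℕ} (A : Matrix (Fin m) (Fin n) ℝ) :
    spectralGramNorm.toFun A = spectralNorm2 A := by
  -- The two sides differ only in the `DecidableEq` instance.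
  unfold spectralGramNorm spectralNorm2
  congr!

variable {k κ₁ κ₂ m : Type} [Fintype k] [Fintype κ₁] [Fintype κ₂] [Fintype m] [DecidableEq k]
  [DecidableEq κ₁] [DecidableEq κ₂] {V₁ U₁ : Matrix k κ₁ ℝ} {V₂ U₂ : Matrix k κ₂ ℝ}

/-- `‖A‖² = ‖AᵀA‖`, and `AᵀA` is the sum of the Gram matrices of the two parts. -/
theorem IsFramePair.spectral_split_le (h : IsFramePair V₁ V₂) (A : Matrix k m ℝ) :
    spectralGramNorm.toFun A ^ 2
      ≤ spectralGramNorm.toFun (V₁ᵀ * A) ^ 2 + spectralGramNorm.toFun (V₂ᵀ * A) ^ 2 := by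
  classical
  change ‖A‖ ^ 2 ≤ ‖V₁ᵀ * A‖ ^ 2 + ‖V₂ᵀ * A‖ ^ 2
  rw [l2_opNorm_sq, l2_opNorm_sq, l2_opNorm_sq, h.gram_split A]
  exact norm_add_le _ _

theorem IsFramePair.spectral_split_right_le (h : IsFramePair V₁ V₂) (A : Matrix m k ℝ) :
    spectralGramNorm.toFun A ^ 2
      ≤ spectralGramNorm.toFun (A * V₁) ^ 2 + spectralGramNorm.toFun (A * V₂) ^ 2 := by
  have := h.spectral_split_le Aᵀ
  rwa [← Matrix.transpose_mul, ← Matrix.transpose_mul, GramNorm.transpose, GramNorm.transpose,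
    GramNorm.transpose] at this

theorem SpectralPair.spectral_polarDiff_le {s t : κ₁ → ℝ} {σ τ : ℝ} {Z : Matrix k k ℝ}
    (h : SpectralPair V₁ U₁ V₂ U₂ s t σ τ Z) {ε : ℝ}
    (hε : spectralGramNorm.toFun (diff V₁ U₁ s t Z) ≤ ε) :
    spectralGramNorm.toFun (polarDiff V₁ U₁ Z)
      ≤ √((2 * ε / (σ + τ)) ^ 2 + 2 * (ε / max σ τ) ^ 2) := by
  obtain ⟨h11, h12, h21⟩ := h.norm_blocks_le _ hε
  set f := spectralGramNorm
  have h1 := h.left.spectral_split_le (polarDiff V₁ U₁ Z)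
  have h2 := h.right.spectral_split_right_le (V₁ᵀ * polarDiff V₁ U₁ Z)
  have h3 := h.right.spectral_split_right_le (V₂ᵀ * polarDiff V₁ U₁ Z)
  rw [h.block_two_two, GramNorm.zero] at h3
  have q11 := pow_le_pow_left₀ (f.nonneg _) h11 2
  have q12 := pow_le_pow_left₀ (f.nonneg _) h12 2
  have q21 := pow_le_pow_left₀ (f.nonneg _) h21 2
  exact Real.le_sqrt_of_sq_le (by linarith)

theorem spectralNorm2_nonneg {m n : ℕ} (D : Matrix (Fin m) (Fin n) ℝ) : 0 ≤ spectralNorm2 D :=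
  norm_nonneg D

theorem posSemidef_spectralNorm_sq_sub {m n : ℕ} (D : Matrix (Fin m) (Fin n) ℝ) :
    (spectralNorm2 D ^ 2 • 1 - D * Dᵀ).PosSemidef := by
  refine Matrix.PosSemidef.of_dotProduct_mulVec_nonneg ?_ fun x => ?_
  · simp [Matrix.IsHermitian, Matrix.conjTranspose_eq_transpose_of_trivial]
  have h := Matrix.l2_opNorm_mulVec Dᵀ (WithLp.toLp 2 x)
  have hD : ‖Dᵀ‖ = spectralNorm2 D := by
    rw [← Matrix.conjTranspose_eq_transpose_of_trivial, Matrix.l2_opNorm_conjTranspose]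
    rfl
  rw [hD] at h
  have h2 := pow_le_pow_left₀ (norm_nonneg _) h 2
  rw [mul_pow, EuclideanSpace.norm_sq_eq, EuclideanSpace.norm_sq_eq] at h2
  have h3 : x ⬝ᵥ (D * Dᵀ) *ᵥ x = (Dᵀ *ᵥ x) ⬝ᵥ (Dᵀ *ᵥ x) := by
    rw [← Matrix.mulVec_mulVec, Matrix.dotProduct_mulVec, Matrix.mulVec_transpose]
  rw [Matrix.sub_mulVec, dotProduct_sub, star_trivial, h3, Matrix.smul_mulVec, Matrix.one_mulVec,
    dotProduct_smul, sub_nonneg]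
  simpa [dotProduct, sq] using h2

end Spectral

/-! ### Singular values, spectral forms and canonical angles -/

theorem mul_diagonal_mul_transpose_apply {m n : Type*} [Fintype n] [DecidableEq n]
    (A : Matrix m n ℝ) (d : n → ℝ) (i j : m) :
    (A * Matrix.diagonal d * Aᵀ) i j = ∑ x, A i x * d x * A j x := by
  rw [Matrix.mul_apply]
  simp only [Matrix.mul_diagonal, Matrix.transpose_apply]

theorem exists_gram_eq_singularValues {m n : ℕ} (A : Matrix (Fin m) (Fin n) ℝ) :
    ∃ V : Matrix (Fin n) (Fin n) ℝ, Vᵀ * V = 1 ∧ Aᵀ * A = V * Matrix.diagonal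
      (fun i : Fin n => (Matrix.toEuclideanLin A).singularValues i ^ 2) * Vᵀ := by
  set T := Matrix.toEuclideanLin A
  obtain ⟨b, hb⟩ : ∃ b : OrthonormalBasis (Fin n) ℝ (EuclideanSpace ℝ (Fin n)),
      ∀ j, (LinearMap.adjoint T ∘ₗ T) (b j) = (T.singularValues j ^ 2) • b j := by
    refine ⟨T.isSymmetric_adjoint_comp_self.eigenvectorBasis finrank_euclideanSpace_fin,
      fun j => ?_⟩
    rw [T.isSymmetric_adjoint_comp_self.apply_eigenvectorBasis,
      T.sq_singularValues_fin finrank_euclideanSpace_fin]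
    rfl
  set V : Matrix (Fin n) (Fin n) ℝ := Matrix.of fun i j => b j i
  have hV : Vᵀ * V = 1 := by
    ext i j
    rw [Matrix.mul_apply, Matrix.one_apply, ← orthonormal_iff_ite.1 b.orthonormal i j,
      PiLp.inner_apply]
    refine Finset.sum_congr rfl fun x _ => ?_
    rw [real_inner_comm]
    rfl
  refine ⟨V, hV, ?_⟩
  have h : Aᵀ * A * V = V * Matrix.diagonal (fun i : Fin n => T.singularValues i ^ 2) := by
    ext i j
    have h1 := hb j
    rw [LinearMap.comp_apply, ← Matrix.toEuclideanLin_conjTranspose_eq_adjoint,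
      Matrix.conjTranspose_eq_transpose_of_trivial] at h1
    have h2 := congrArg (fun v : EuclideanSpace ℝ (Fin n) => v i) h1
    simp only [T, Matrix.toLpLin_apply, Matrix.mulVec_mulVec] at h2
    rw [Matrix.mul_diagonal, mul_comm]
    exact h2
  rw [← h, Matrix.mul_assoc, mul_eq_one_comm.1 hV, Matrix.mul_one]

/-- `H² = V diag(σᵢ²) Vᵀ` and uniqueness of the positive semidefinite square root give `H = V
diag(σᵢ) Vᵀ`; the singular values beyond the rank vanish. -/
theorem exists_spectral_form {k r : ℕ} (H : Matrix (Fin k) (Fin k) ℝ) (hH : H.PosSemidef)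
    (hr : H.rank = r) :
    ∃ (V₁ : Matrix (Fin k) {i : Fin k // (i : ℕ) < r} ℝ)
      (V₂ : Matrix (Fin k) {i : Fin k // ¬ (i : ℕ) < r} ℝ)
      (s : {i : Fin k // (i : ℕ) < r} → ℝ), IsFramePair V₁ V₂ ∧
      H = V₁ * Matrix.diagonal s * V₁ᵀ ∧ (∀ i, 0 < s i) ∧ ∀ i, sigma H r ≤ s i := by
  obtain ⟨V, hV, hVH⟩ := exists_gram_eq_singularValues H
  set T := Matrix.toEuclideanLin H
  have hV' := mul_eq_one_comm.1 hV
  have hrank : Module.finrank ℝ (LinearMap.range T) = r := by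
    rw [← hr, Matrix.rank_eq_finrank_range_toLin H (EuclideanSpace.basisFun _ ℝ).toBasis
      (EuclideanSpace.basisFun _ ℝ).toBasis]
    congr 2
  have hsplit : ∀ d : Fin k → ℝ, (∀ i : Fin k, ¬ (i : ℕ) < r → d i = 0) →
      V * Matrix.diagonal d * Vᵀ
        = V.submatrix id (Subtype.val : {i : Fin k // (i : ℕ) < r} → Fin k)
          * Matrix.diagonal (fun i : {i : Fin k // (i : ℕ) < r} => d i) * (V.submatrix id Subtype.val)ᵀ := by
    intro d hd
    ext i j
    rw [mul_diagonal_mul_transpose_apply,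
      ← Fintype.sum_subtype_add_sum_subtype (fun i : Fin k => (i : ℕ) < r)]
    refine Eq.trans (add_eq_left.2 ?_) (mul_diagonal_mul_transpose_apply
      (V.submatrix id Subtype.val) (fun i : {i : Fin k // (i : ℕ) < r} => d i) i j).symm
    exact Finset.sum_eq_zero fun x _ => by rw [hd x.1 x.2]; ring
  refine ⟨V.submatrix id Subtype.val, V.submatrix id Subtype.val,
    fun i => T.singularValues i, ⟨?_, ?_, ?_⟩, ?_, ?_, ?_⟩
  · ext i j
    have := congrFun (congrFun hV i) j
    simpa [Matrix.mul_apply, Matrix.one_apply, Subtype.ext_iff] using this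
  · ext i j
    have := congrFun (congrFun hV i) j
    simpa [Matrix.mul_apply, Matrix.one_apply, Subtype.ext_iff] using this
  · rw [← hV']
    ext i j
    simp only [Matrix.mul_apply, Matrix.add_apply, Matrix.transpose_apply,
      Matrix.submatrix_apply, id]
    exact Fintype.sum_subtype_add_sum_subtype (fun i : Fin k => (i : ℕ) < r)
      (fun x => V i x * V j x)
  · refine Eq.trans (hH.eq_of_mul_self_eq ?_ ?_) (hsplit (fun i : Fin k => T.singularValues i)
      fun i hi => T.singularValues_eq_zero_iff_le_finrank_range.2 (by omega))
    · have := (Matrix.PosSemidef.diagonal (d := fun i : Fin k => T.singularValues i)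
        fun i => T.singularValues_nonneg i).mul_mul_conjTranspose_same V
      rwa [Matrix.conjTranspose_eq_transpose_of_trivial] at this
    · rw [hH.transpose_eq] at hVH
      have h : ∀ A : Matrix (Fin k) (Fin k) ℝ, Vᵀ * (V * A) = A := fun A => by
        rw [← Matrix.mul_assoc, hV, Matrix.one_mul]
      rw [hVH]
      simp only [Matrix.mul_assoc, h]
      rw [← Matrix.mul_assoc (Matrix.diagonal _), Matrix.diagonal_mul_diagonal]
      simp only [sq]
  · exact fun i => T.singularValues_pos_iff_lt_finrank_range.2 (hrank ▸ i.2)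
  -- `sigma H r` is the singular value with zero-based index `r - 1`, the largest index below `r`.
  · exact fun i => T.singularValues_antitone (by have := i.2; omega)

theorem sigma_rank_pos {k r : ℕ} (H : Matrix (Fin k) (Fin k) ℝ) (hr : H.rank = r) (h0 : r ≠ 0) :
    0 < sigma H r := by
  rw [sigma, LinearMap.singularValues_pos_iff_lt_finrank_range]
  have hrank : Module.finrank ℝ (LinearMap.range (Matrix.toEuclideanLin H)) = r := by
    rw [← hr, Matrix.rank_eq_finrank_range_toLin H (EuclideanSpace.basisFun _ ℝ).toBasis
      (EuclideanSpace.basisFun _ ℝ).toBasis]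
    congr 2
  omega

theorem norm_sinTheta (f : GramNorm) {n k : ℕ} (X X' : Matrix (Fin n) (Fin k) ℝ)
    (hX : Xᵀ * X = 1) (hX' : X'ᵀ * X' = 1) :
    f.toFun (sinTheta X X') = f.toFun (X' - X * (Xᵀ * X')) := by
  obtain ⟨V, hV, hVM⟩ := exists_gram_eq_singularValues (Xᵀ * X')
  set T := Matrix.toEuclideanLin (Xᵀ * X')
  have hV' := mul_eq_one_comm.1 hV
  have hpsd : (1 - (Xᵀ * X')ᵀ * (Xᵀ * X')).PosSemidef := posSemidef_one_sub_gram X X' hX hX'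
  have hle : ∀ i : Fin k, T.singularValues i ^ 2 ≤ 1 := by
    intro i
    have h1 := hpsd.conjTranspose_mul_mul_same V
    rw [Matrix.conjTranspose_eq_transpose_of_trivial, hVM] at h1
    have h2 : Vᵀ * (1 - V * Matrix.diagonal (fun i : Fin k => T.singularValues i ^ 2) * Vᵀ) * V
        = 1 - Matrix.diagonal (fun i : Fin k => T.singularValues i ^ 2) := by
      have h : ∀ A : Matrix (Fin k) (Fin k) ℝ, Vᵀ * (V * A) = A := fun A => by
        rw [← Matrix.mul_assoc, hV, Matrix.one_mul]
      simp [Matrix.mul_sub, Matrix.sub_mul, Matrix.mul_assoc, h, hV]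
    rw [h2] at h1
    have h3 := h1.diag_nonneg (i := i)
    simpa using h3
  -- `sigma _ (k - i)` has zero-based index `k - i - 1`, which is `Fin.rev i`; hence the columns of
  -- `V` are reversed below.
  have hsin : sinTheta X X' = Matrix.diagonal
      (fun i : Fin k => √(1 - T.singularValues (Fin.rev i) ^ 2)) := by
    unfold sinTheta canonicalAngle sigma
    congr 1
    ext i
    rw [Real.sin_arccos]
    congr 4
  set U := V.submatrix id Fin.rev
  have hU : Uᵀ * U = 1 := by
    ext i j
    have := congrFun (congrFun hV (Fin.rev i)) (Fin.rev j)
    simpa [U, Matrix.mul_apply, Matrix.one_apply] using this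
  rw [← f.mul_isometry_transpose U hU]
  apply f.gram
  have h1 : 1 - V * Matrix.diagonal (fun i : Fin k => T.singularValues i ^ 2) * Vᵀ
      = V * Matrix.diagonal (fun i : Fin k => 1 - T.singularValues i ^ 2) * Vᵀ := by
    rw [← hV', ← Matrix.diagonal_sub, Matrix.diagonal_one]
    simp [Matrix.mul_sub, Matrix.sub_mul]
  rw [gram_sub_proj X X' hX hX', hVM, h1, hsin, Matrix.transpose_mul, Matrix.diagonal_transpose,
    Matrix.transpose_transpose, Matrix.mul_assoc, ← Matrix.mul_assoc (Matrix.diagonal _),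
    Matrix.diagonal_mul_diagonal, ← Matrix.mul_assoc]
  ext i j
  rw [mul_diagonal_mul_transpose_apply, mul_diagonal_mul_transpose_apply, ← Equiv.sum_comp Fin.revPerm]
  refine Finset.sum_congr rfl fun x _ => ?_
  rw [Real.mul_self_sqrt (sub_nonneg.2 (hle _))]
  simp [U]

/-! ### The admissible set: parametrization, compactness, minimum -/

section Admissible

variable {n k : ℕ} {D X : Matrix (Fin n) (Fin k) ℝ} {S : Submodule ℝ (Fin n → ℝ)}

/-- For `Y` admissible put `G = XᵀY`. Then `YᵀD = GᵀH` is positive semidefinite with square `HGGᵀH =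
H²`, so it equals `H`. -/
theorem admissibleBases_eq_image (hX : IsOrthonormalBasisMatrix X S)
    (hXD : (Xᵀ * D).PosSemidef) : admissibleBases D S =
      (fun G => X * G) '' {G | Gᵀ * G = 1 ∧ Gᵀ * (Xᵀ * D) = Xᵀ * D} := by
  obtain ⟨hX1, hXS⟩ := hX
  ext Y
  constructor
  · rintro ⟨⟨hY1, hYS⟩, hYD⟩
    have hY : Y = X * (Xᵀ * Y) := by
      have hcol : ∀ v, ∃ w, X *ᵥ w = Y *ᵥ v := fun v => by
        have : Y *ᵥ v ∈ LinearMap.range X.mulVecLin := by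
          rw [hXS, ← hYS]
          exact ⟨v, rfl⟩
        simpa using this
      apply Matrix.ext_of_mulVec_single
      intro j
      obtain ⟨w, hw⟩ := hcol (Pi.single j 1)
      rw [← Matrix.mulVec_mulVec, ← Matrix.mulVec_mulVec, ← hw, Matrix.mulVec_mulVec w Xᵀ, hX1,
        Matrix.one_mulVec]
    have hG : (Xᵀ * Y)ᵀ * (Xᵀ * Y) = 1 := by
      rw [Matrix.transpose_mul, Matrix.transpose_transpose, Matrix.mul_assoc, ← hY, hY1]
    have hYD' : Yᵀ * D = (Xᵀ * Y)ᵀ * (Xᵀ * D) := by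
      rw [← Matrix.mul_assoc, ← Matrix.transpose_mul, ← hY]
    refine ⟨Xᵀ * Y, ⟨hG, ?_⟩, hY.symm⟩
    rw [hYD'] at hYD
    refine hYD.eq_of_mul_self_eq hXD ?_
    nth_rewrite 1 [← hYD.transpose_eq]
    rw [Matrix.transpose_mul, Matrix.transpose_transpose, hXD.transpose_eq, Matrix.mul_assoc,
      ← Matrix.mul_assoc (Xᵀ * Y), mul_eq_one_comm.1 hG, Matrix.one_mul]
  · rintro ⟨G, ⟨hG, hGH⟩, rfl⟩
    refine ⟨⟨?_, ?_⟩, ?_⟩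
    · rw [Matrix.transpose_mul, Matrix.mul_assoc, ← Matrix.mul_assoc Xᵀ, hX1, Matrix.one_mul, hG]
    · rw [← hXS]
      apply le_antisymm
      · rintro _ ⟨v, rfl⟩
        exact ⟨G *ᵥ v, by simp⟩
      · rintro _ ⟨v, rfl⟩
        exact ⟨Gᵀ *ᵥ v, by simp [mul_eq_one_comm.1 hG]⟩
    · rwa [Matrix.transpose_mul, Matrix.mul_assoc, hGH]

theorem isCompact_admissibleBases (hX : IsOrthonormalBasisMatrix X S)
    (hXD : (Xᵀ * D).PosSemidef) : IsCompact (admissibleBases D S) := by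
  rw [admissibleBases_eq_image hX hXD]
  refine IsCompact.image ?_ (by fun_prop)
  refine (isCompact_univ_pi fun _ : Fin k => isCompact_univ_pi fun _ : Fin k =>
    isCompact_Icc (a := (-1 : ℝ)) (b := 1)).of_isClosed_subset ?_ ?_
  · exact (isClosed_eq (by fun_prop) (by fun_prop)).inter
      (isClosed_eq (by fun_prop) (by fun_prop))
  · intro (G : Matrix (Fin k) (Fin k) ℝ) hG i _ j _
    have hG' : G ∈ Matrix.unitaryGroup (Fin k) ℝ := by
      rw [Matrix.mem_unitaryGroup_iff']
      exact hG.1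
    have := entry_norm_bound_of_unitary hG' i j
    rwa [Real.norm_eq_abs, abs_le] at this

open scoped Matrix.Norms.L2Operator in
-- The bound `f(A) ≤ f(1) ‖A‖₂` makes the seminorm Lipschitz.
theorem GramNorm.continuous (f : GramNorm) :
    Continuous fun A : Matrix (Fin n) (Fin k) ℝ => f.toFun A := by
  have hle : ∀ A : Matrix (Fin n) (Fin k) ℝ,
      f.toFun A ≤ f.toFun (1 : Matrix (Fin n) (Fin n) ℝ) * ‖A‖ := fun A => by
    have := f.mul_le_right (1 : Matrix (Fin n) (Fin n) ℝ) A (spectralNorm2 A) (spectralNorm2_nonneg A)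
      (posSemidef_spectralNorm_sq_sub A)
    rw [Matrix.one_mul, mul_comm] at this
    exact this
  refine (LipschitzWith.of_dist_le_mul (K := NNReal.mk (f.toFun (1 : Matrix (Fin n) (Fin n) ℝ))
    (f.nonneg _)) fun A B => ?_).continuous
  rw [Real.dist_eq, dist_eq_norm, abs_sub_le_iff, NNReal.coe_mk]
  have h1 := f.add_le (A - B) B
  have h2 := f.add_le (B - A) A
  have h3 := hle (A - B)
  have h4 := f.neg (A - B)
  rw [neg_sub] at h4
  rw [sub_add_cancel] at h1 h2
  exact ⟨by linarith, by linarith⟩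

theorem exists_isLeast_norm (f : GramNorm) (hX : IsOrthonormalBasisMatrix X S)
    (hXD : (Xᵀ * D).PosSemidef) (X' : Matrix (Fin n) (Fin k) ℝ) :
    ∃ μ, IsLeast ((fun Y => f.toFun (X' - Y)) '' admissibleBases D S) μ := by
  refine ((isCompact_admissibleBases hX hXD).image
    (f.continuous.comp (continuous_const.sub continuous_id))).exists_isLeast ?_
  refine Set.Nonempty.image _ ⟨X, hX, hXD⟩

theorem exists_isLeast_norm_le (f : GramNorm) (hX : IsOrthonormalBasisMatrix X S)
    (hXD : (Xᵀ * D).PosSemidef) {X' G : Matrix (Fin n) (Fin k) ℝ} {C : ℝ}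
    (hG : G ∈ admissibleBases D S) (hC : f.toFun (X' - G) ≤ C) :
    ∃ μ, IsLeast ((fun Y => f.toFun (X' - Y)) '' admissibleBases D S) μ ∧ μ ≤ C := by
  obtain ⟨μ, hμ⟩ := exists_isLeast_norm f hX hXD X'
  exact ⟨μ, hμ, (hμ.2 ⟨G, hG, rfl⟩).trans hC⟩

end Admissible

/-! ### Orthogonal matrices that fix the range -/

section Fixed

variable {k : Type} [Fintype k] [DecidableEq k] {κ₁ κ₂ : Type} [Fintype κ₁] [Fintype κ₂]
  [DecidableEq κ₁] [DecidableEq κ₂] {V₁ : Matrix k κ₁ ℝ} {V₂ : Matrix k κ₂ ℝ} {s : κ₁ → ℝ}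

theorem IsFramePair.rotation_orthogonal (h : IsFramePair V₁ V₂) (s : κ₁ → ℝ)
    (W : Matrix κ₂ κ₂ ℝ) (hW : Wᵀ * W = 1) :
    (V₁ * V₁ᵀ + V₂ * W * V₂ᵀ)ᵀ * (V₁ * V₁ᵀ + V₂ * W * V₂ᵀ) = 1 ∧
    (V₁ * V₁ᵀ + V₂ * W * V₂ᵀ)ᵀ * (V₁ * Matrix.diagonal s * V₁ᵀ)
      = V₁ * Matrix.diagonal s * V₁ᵀ := by
  have hWW : ∀ A : Matrix κ₂ k ℝ, Wᵀ * (W * A) = A := fun A => by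
    rw [← Matrix.mul_assoc, hW, Matrix.one_mul]
  constructor
  · rw [← h.sum]
    simp [Matrix.mul_add, Matrix.add_mul, Matrix.mul_assoc, h.fst_mul, h.symm.fst_mul,
      h.ortho_mul, h.symm.ortho_mul, hWW]
  · simp [Matrix.add_mul, Matrix.mul_assoc, h.fst_mul, h.symm.ortho_mul]

theorem IsFramePair.mul_fst_of_fixes (h : IsFramePair V₁ V₂) (hs : ∀ i, 0 < s i)
    {G : Matrix k k ℝ} (hG : Gᵀ * G = 1)
    (hGH : Gᵀ * (V₁ * Matrix.diagonal s * V₁ᵀ) = V₁ * Matrix.diagonal s * V₁ᵀ) :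
    G * V₁ = V₁ := by
  have h1 : G * (V₁ * Matrix.diagonal s * V₁ᵀ) = V₁ * Matrix.diagonal s * V₁ᵀ := by
    rw [← hGH, ← Matrix.mul_assoc G, mul_eq_one_comm.1 hG, Matrix.one_mul, hGH]
  have h2 : ∀ A : Matrix k κ₁ ℝ,
      A = A * Matrix.diagonal s * Matrix.diagonal (fun i => (s i)⁻¹) := fun A => by
    rw [Matrix.mul_assoc, Matrix.diagonal_mul_diagonal]
    simp [fun i => mul_inv_cancel₀ (hs i).ne']
  have h3 := congrArg (· * V₁) h1
  simp only [Matrix.mul_assoc, h.fst, Matrix.mul_one] at h3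
  rw [h2 (G * V₁), Matrix.mul_assoc G, h3, ← h2]

end Fixed

theorem GramNorm.eq_zero_of_isEmpty (f : GramNorm) {m n : Type} [Fintype m] [Fintype n]
    [IsEmpty n] (A : Matrix m n ℝ) : f.toFun A = 0 := by
  rw [Subsingleton.elim A 0, f.zero]

/-- At full rank only the Sylvester block is nonempty, so the `max` terms disappear. -/
theorem SpectralPair.norm_polarDiff_le_of_isEmpty {k κ₁ κ₂ : Type} [Fintype k] [Fintype κ₁]
    [Fintype κ₂] [DecidableEq k] [DecidableEq κ₁] [DecidableEq κ₂] [IsEmpty κ₂]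
    {V₁ U₁ : Matrix k κ₁ ℝ} {V₂ U₂ : Matrix k κ₂ ℝ} {s t : κ₁ → ℝ} {σ τ : ℝ}
    {Z : Matrix k k ℝ} (f : GramNorm) (h : SpectralPair V₁ U₁ V₂ U₂ s t σ τ Z) {ε : ℝ}
    (hε : f.toFun (diff V₁ U₁ s t Z) ≤ ε) : f.toFun (polarDiff V₁ U₁ Z) ≤ 2 * ε / (σ + τ) := by
  obtain ⟨h11, -, -⟩ := h.norm_blocks_le f hε
  have h1 := h.left.norm_split_le f (polarDiff V₁ U₁ Z)
  have h2 := h.right.norm_split_right_le f (V₁ᵀ * polarDiff V₁ U₁ Z)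
  rw [f.eq_zero_of_isEmpty (V₁ᵀ * polarDiff V₁ U₁ Z * U₂)] at h2
  rw [← f.transpose (V₂ᵀ * polarDiff V₁ U₁ Z), f.eq_zero_of_isEmpty (V₂ᵀ * _)ᵀ] at h1
  linarith

/-! ### The perturbation bounds -/

section Perturbation

variable {n k r : ℕ} {D X X' : Matrix (Fin n) (Fin k) ℝ} {S : Submodule ℝ (Fin n → ℝ)}

/-- Reduction of the bound to the perturbation of subunitary polar factors. -/
theorem exists_basis_norm_sub_le (hX : IsOrthonormalBasisMatrix X S)
    (hXD : (Xᵀ * D).PosSemidef) (hX' : X'ᵀ * X' = 1) (hXD' : (X'ᵀ * D).PosSemidef)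
    (hr : (Xᵀ * D).rank = r) (hr' : (X'ᵀ * D).rank = r) (h0 : r ≠ 0) :
    ∃ (V₁ U₁ : Matrix (Fin k) {i : Fin k // (i : ℕ) < r} ℝ)
      (V₂ U₂ : Matrix (Fin k) {i : Fin k // ¬ (i : ℕ) < r} ℝ)
      (s t : {i : Fin k // (i : ℕ) < r} → ℝ) (Z : Matrix (Fin k) (Fin k) ℝ),
      SpectralPair V₁ U₁ V₂ U₂ s t (sigma (Xᵀ * D) r) (sigma (X'ᵀ * D) r) Z ∧
      ∃ Y ∈ admissibleBases D S, ∀ f : GramNorm,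
        f.toFun (SpectralPair.diff V₁ U₁ s t Z)
          ≤ √2 * spectralNorm2 D * f.toFun (sinTheta X X') ∧
        f.toFun (X' - Y) ≤ √2 * f.toFun (sinTheta X X')
          + f.toFun (SpectralPair.polarDiff V₁ U₁ Z)
          + if r = k then 0 else 4 * spectralNorm2 D * f.toFun (sinTheta X X')
            / max (sigma (Xᵀ * D) r) (sigma (X'ᵀ * D) r) := by
  obtain ⟨V₁, V₂, s, hV, hH, -, hs⟩ := exists_spectral_form _ hXD hr
  obtain ⟨U₁, U₂, t, hU, hH', -, ht⟩ := exists_spectral_form _ hXD' hr'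
  obtain ⟨Z, hZ, hZf⟩ := exists_alignment X X' hX.1 hX'
  have hP : SpectralPair V₁ U₁ V₂ U₂ s t (sigma (Xᵀ * D) r) (sigma (X'ᵀ * D) r) Z :=
    ⟨hV, hU, sigma_rank_pos _ hr h0, sigma_rank_pos _ hr' h0, hs, ht, hZ⟩
  obtain ⟨W, hW, hWf⟩ := hP.exists_rotation
  have hdiff : ∀ f : GramNorm, f.toFun (SpectralPair.diff V₁ U₁ s t Z)
      ≤ √2 * spectralNorm2 D * f.toFun (sinTheta X X') := by
    intro f
    have h1 : SpectralPair.diff V₁ U₁ s t Z = -(Z * ((X' - X * Z)ᵀ * D)) := by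
      have h2 : Z * (Zᵀ * (Xᵀ * D)) = Xᵀ * D := by
        rw [← Matrix.mul_assoc, mul_eq_one_comm.1 hZ, Matrix.one_mul]
      rw [SpectralPair.diff, ← hH, ← hH']
      simp [Matrix.mul_sub, Matrix.sub_mul, Matrix.mul_assoc, h2]
    have h3 := f.mul_le_right (X' - X * Z)ᵀ D (spectralNorm2 D) (spectralNorm2_nonneg D)
      (posSemidef_spectralNorm_sq_sub D)
    have h4 := hZf f
    rw [← norm_sinTheta f X X' hX.1 hX'] at h4
    rw [h1, f.neg, f.isometry_mul Z hZ]
    rw [f.transpose] at h3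
    have h5 := mul_le_mul_of_nonneg_left h4 (spectralNorm2_nonneg D)
    linarith
  obtain ⟨hG, hGH⟩ := hV.rotation_orthogonal s W hW
  refine ⟨V₁, U₁, V₂, U₂, s, t, Z, hP, X * (V₁ * V₁ᵀ + V₂ * W * V₂ᵀ), ?_, fun f => ⟨hdiff f, ?_⟩⟩
  · rw [admissibleBases_eq_image hX hXD]
    exact ⟨_, ⟨hG, by rw [hH]; exact hGH⟩, rfl⟩
  have e : X' - X * (V₁ * V₁ᵀ + V₂ * W * V₂ᵀ) = (X' - X * Z)
      - X * (SpectralPair.polarDiff V₁ U₁ Z + (V₂ * W * V₂ᵀ - Z * (U₂ * U₂ᵀ))) := by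
    have hZ' : Z = Z * (U₁ * U₁ᵀ) + Z * (U₂ * U₂ᵀ) := by
      rw [← Matrix.mul_add, hU.sum, Matrix.mul_one]
    have : SpectralPair.polarDiff V₁ U₁ Z + (V₂ * W * V₂ᵀ - Z * (U₂ * U₂ᵀ))
        = V₁ * V₁ᵀ + V₂ * W * V₂ᵀ - Z := by
      conv_rhs => rw [hZ']
      rw [SpectralPair.polarDiff]
      abel
    rw [this, Matrix.mul_sub]
    abel
  have h1 := f.sub_le (X' - X * Z)
    (X * (SpectralPair.polarDiff V₁ U₁ Z + (V₂ * W * V₂ᵀ - Z * (U₂ * U₂ᵀ))))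
  have h2 := f.add_le (SpectralPair.polarDiff V₁ U₁ Z) (V₂ * W * V₂ᵀ - Z * (U₂ * U₂ᵀ))
  have h3 := hZf f
  rw [← norm_sinTheta f X X' hX.1 hX'] at h3
  rw [← e, f.isometry_mul X hX.1] at h1
  have h4 : f.toFun (V₂ * W * V₂ᵀ - Z * (U₂ * U₂ᵀ)) ≤ if r = k then 0 else
      4 * spectralNorm2 D * f.toFun (sinTheta X X')
        / max (sigma (Xᵀ * D) r) (sigma (X'ᵀ * D) r) := by
    split_ifs with hrk
    · have : IsEmpty {i : Fin k // ¬ (i : ℕ) < r} := ⟨fun i => i.2 (hrk ▸ i.1.2)⟩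
      rw [Subsingleton.elim V₂ 0, Subsingleton.elim U₂ 0]
      simp [f.zero]
    -- The constant is `2√2 · √2 = 4`.
    · refine (hWf f _ (hdiff f)).trans (le_of_eq ?_)
      have := Real.mul_self_sqrt zero_le_two
      linear_combination (2 * spectralNorm2 D * f.toFun (sinTheta X X')
        / max (sigma (Xᵀ * D) r) (sigma (X'ᵀ * D) r)) * this
  linarith

/-- Here `XᵀD = 0`, so every orthogonal `G` is allowed and the alignment `Z` itself can be used. -/
theorem exists_basis_norm_sub_le_of_rank_zero (hX : IsOrthonormalBasisMatrix X S)
    (hXD : (Xᵀ * D).PosSemidef) (hX' : X'ᵀ * X' = 1) (hr : (Xᵀ * D).rank = 0) :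
    ∃ Y ∈ admissibleBases D S, ∀ f : GramNorm,
      f.toFun (X' - Y) ≤ √2 * f.toFun (sinTheta X X') := by
  obtain ⟨Z, hZ, hZf⟩ := exists_alignment X X' hX.1 hX'
  refine ⟨X * Z, ?_, fun f => by rw [norm_sinTheta f X X' hX.1 hX']; exact hZf f⟩
  rw [admissibleBases_eq_image hX hXD]
  refine ⟨Z, ⟨hZ, ?_⟩, rfl⟩
  obtain ⟨V₁, -, s, -, hH, -, -⟩ := exists_spectral_form _ hXD hr
  have : IsEmpty {i : Fin k // (i : ℕ) < 0} := ⟨fun i => Nat.not_lt_zero _ i.2⟩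
  rw [hH, Subsingleton.elim V₁ 0]
  simp

theorem exists_isLeast_norm_le_eta (f : GramNorm) (hX : IsOrthonormalBasisMatrix X S)
    (hXD : (Xᵀ * D).PosSemidef) (hX' : X'ᵀ * X' = 1) (hXD' : (X'ᵀ * D).PosSemidef)
    (hr : (Xᵀ * D).rank = r) (hr' : (X'ᵀ * D).rank = r) :
    ∃ μ, IsLeast ((fun Y => f.toFun (X' - Y)) '' admissibleBases D S) μ ∧
      μ ≤ eta k r (spectralNorm2 D) (sigma (Xᵀ * D) r) (sigma (X'ᵀ * D) r) *
        f.toFun (sinTheta X X') := by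
  rcases eq_or_ne r 0 with h0 | h0
  · obtain ⟨Y, hY, hYf⟩ := exists_basis_norm_sub_le_of_rank_zero hX hXD hX' (hr.trans h0)
    exact exists_isLeast_norm_le f hX hXD hY (by rw [eta, if_pos h0]; exact hYf f)
  obtain ⟨V₁, U₁, V₂, U₂, s, t, Z, hP, Y, hY, hYf⟩ :=
    exists_basis_norm_sub_le hX hXD hX' hXD' hr hr' h0
  obtain ⟨h1, h2⟩ := hYf f
  refine exists_isLeast_norm_le f hX hXD hY (h2.trans ?_)
  rw [eta, if_neg h0]
  split_ifs with hrk
  · have : IsEmpty {i : Fin k // ¬ (i : ℕ) < r} := ⟨fun i => i.2 (hrk ▸ i.1.2)⟩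
    have h3 := hP.norm_polarDiff_le_of_isEmpty f h1
    refine (add_le_add_left (add_le_add_right h3 _) _).trans (le_of_eq ?_)
    ring
  · have h3 := hP.norm_polarDiff_le f h1
    refine (add_le_add_left (add_le_add_right h3 _) _).trans (le_of_eq ?_)
    ring

theorem exists_isLeast_frobeniusNorm_le (hX : IsOrthonormalBasisMatrix X S)
    (hXD : (Xᵀ * D).PosSemidef) (hX' : X'ᵀ * X' = 1) (hXD' : (X'ᵀ * D).PosSemidef)
    (hr : (Xᵀ * D).rank = r) (hr' : (X'ᵀ * D).rank = r) (hrk : r < k) :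
    ∃ μ, IsLeast ((fun Y => frobeniusNorm (X' - Y)) '' admissibleBases D S) μ ∧
      μ ≤ etaFrobenius r (spectralNorm2 D) (sigma (Xᵀ * D) r) (sigma (X'ᵀ * D) r) *
        frobeniusNorm (sinTheta X X') := by
  simp only [← frobeniusGramNorm_apply]
  rcases eq_or_ne r 0 with h0 | h0
  · obtain ⟨Y, hY, hYf⟩ := exists_basis_norm_sub_le_of_rank_zero hX hXD hX' (hr.trans h0)
    exact exists_isLeast_norm_le _ hX hXD hY (by rw [etaFrobenius, if_pos h0]; exact hYf _)
  obtain ⟨V₁, U₁, V₂, U₂, s, t, Z, hP, Y, hY, hYf⟩ :=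
    exists_basis_norm_sub_le hX hXD hX' hXD' hr hr' h0
  obtain ⟨h1, h2⟩ := hYf frobeniusGramNorm
  refine exists_isLeast_norm_le _ hX hXD hY (h2.trans ?_)
  rw [etaFrobenius, if_neg h0, if_neg hrk.ne]
  refine (add_le_add_left (add_le_add_right (hP.frobenius_polarDiff_le h1) _) _).trans
    (le_of_eq ?_)
  ring

theorem exists_isLeast_spectralNorm2_le (hX : IsOrthonormalBasisMatrix X S)
    (hXD : (Xᵀ * D).PosSemidef) (hX' : X'ᵀ * X' = 1) (hXD' : (X'ᵀ * D).PosSemidef)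
    (hr : (Xᵀ * D).rank = r) (hr' : (X'ᵀ * D).rank = r) (hrk : r < k) :
    ∃ μ, IsLeast ((fun Y => spectralNorm2 (X' - Y)) '' admissibleBases D S) μ ∧
      μ ≤ etaSpectral r (spectralNorm2 D) (sigma (Xᵀ * D) r) (sigma (X'ᵀ * D) r) *
        spectralNorm2 (sinTheta X X') := by
  rw [← spectralGramNorm_apply (sinTheta X X')]
  simp only [← spectralGramNorm_apply (X' - _)]
  rcases eq_or_ne r 0 with h0 | h0
  · obtain ⟨Y, hY, hYf⟩ := exists_basis_norm_sub_le_of_rank_zero hX hXD hX' (hr.trans h0)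
    exact exists_isLeast_norm_le _ hX hXD hY (by rw [etaSpectral, if_pos h0]; exact hYf _)
  obtain ⟨V₁, U₁, V₂, U₂, s, t, Z, hP, Y, hY, hYf⟩ :=
    exists_basis_norm_sub_le hX hXD hX' hXD' hr hr' h0
  obtain ⟨h1, h2⟩ := hYf spectralGramNorm
  refine exists_isLeast_norm_le _ hX hXD hY (h2.trans ?_)
  rw [etaSpectral, if_neg h0, if_neg hrk.ne]
  have h3 := hP.spectral_polarDiff_le h1
  -- With `ε = √2 d x`, the factor `x`, the norm of `sin Θ`, is pulled out of the root.
  have h4 : ∀ d σ m x : ℝ, 0 ≤ x → √((2 * (√2 * d * x) / σ) ^ 2 + 2 * (√2 * d * x / m) ^ 2)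
      = √(8 * d ^ 2 / σ ^ 2 + 4 * d ^ 2 / m ^ 2) * x := by
    intro d σ m x hx
    rw [← Real.sqrt_sq hx, ← Real.sqrt_mul' _ (sq_nonneg x), Real.sqrt_sq hx]
    congr 1
    simp only [mul_pow, div_pow, Real.sq_sqrt zero_le_two]
    ring
  rw [h4 _ _ _ _ (GramNorm.nonneg _ _)] at h3
  refine (add_le_add_left (add_le_add_right h3 _) _).trans (le_of_eq ?_)
  ring

end Perturbation

/-! ### Explicit form of the admissible set -/

section Family

variable {n k r : ℕ} {D X : Matrix (Fin n) (Fin k) ℝ} {S : Submodule ℝ (Fin n → ℝ)}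

theorem IsSymmSVD.isFramePair {H : Matrix (Fin k) (Fin k) ℝ} {V₁ : Matrix (Fin k) (Fin r) ℝ}
    {V₂ : Matrix (Fin k) (Fin (k - r)) ℝ} {s : Fin r → ℝ} (h : IsSymmSVD H V₁ V₂ s) :
    IsFramePair V₁ V₂ := by
  obtain ⟨h1, h2, -⟩ := h
  rw [Matrix.transpose_fromCols, Matrix.fromRows_mul_fromCols, ← Matrix.fromBlocks_one,
    Matrix.fromBlocks_inj] at h1
  rw [Matrix.transpose_fromCols, Matrix.fromCols_mul_fromRows] at h2
  exact ⟨h1.1, h1.2.2.2, h2⟩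

theorem IsSymmSVD.eq {H : Matrix (Fin k) (Fin k) ℝ} {V₁ : Matrix (Fin k) (Fin r) ℝ}
    {V₂ : Matrix (Fin k) (Fin (k - r)) ℝ} {s : Fin r → ℝ} (h : IsSymmSVD H V₁ V₂ s) :
    H = V₁ * Matrix.diagonal s * V₁ᵀ := by
  rw [h.2.2.2.2, Matrix.transpose_fromCols, Matrix.fromCols_mul_fromBlocks,
    Matrix.fromCols_mul_fromRows]
  simp

/-- Both `G` and `Gᵀ` fix `V₁`, so `G` preserves the range of `V₂`, and `W = V₂ᵀGV₂` is its matrix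
there. -/
theorem admissibleBases_eq_basisFamily (hX : IsOrthonormalBasisMatrix X S)
    (hXD : (Xᵀ * D).PosSemidef) {V₁ : Matrix (Fin k) (Fin r) ℝ}
    {V₂ : Matrix (Fin k) (Fin (k - r)) ℝ} {s : Fin r → ℝ} (h : IsSymmSVD (Xᵀ * D) V₁ V₂ s) :
    admissibleBases D S = basisFamily X V₁ V₂ := by
  have hV := h.isFramePair
  have hH := h.eq
  rw [admissibleBases_eq_image hX hXD]
  ext Y
  constructor
  · rintro ⟨G, ⟨hG, hGH⟩, rfl⟩
    rw [hH] at hGH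
    have h1 := hV.mul_fst_of_fixes h.2.2.2.1 hG hGH
    have h2 : V₁ᵀ * G = V₁ᵀ := by
      have : Gᵀ * V₁ = V₁ := by
        conv_lhs => rw [← h1]
        rw [← Matrix.mul_assoc, hG, Matrix.one_mul]
      simpa using congrArg Matrix.transpose this
    have h3 : G * V₂ = V₂ * (V₂ᵀ * (G * V₂)) := by
      rw [← hV.proj_compl, ← Matrix.mul_assoc V₁ᵀ, h2, hV.ortho, Matrix.mul_zero, sub_zero]
    refine ⟨V₂ᵀ * (G * V₂), ?_, ?_⟩
    · rw [Matrix.mem_orthogonalGroup_iff']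
      rw [Matrix.transpose_mul, Matrix.transpose_transpose, Matrix.mul_assoc, ← h3,
        Matrix.transpose_mul, Matrix.mul_assoc, ← Matrix.mul_assoc Gᵀ, hG, Matrix.one_mul, hV.snd]
    · change X * G = _
      have h4 : G = V₁ * V₁ᵀ + G * V₂ * V₂ᵀ := by
        conv_lhs => rw [← Matrix.mul_one G, ← hV.sum, Matrix.mul_add, ← Matrix.mul_assoc, h1,
          ← Matrix.mul_assoc]
      conv_lhs => rw [h4, h3]
      simp only [Matrix.mul_add, Matrix.mul_assoc]
  · rintro ⟨W, hW, rfl⟩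
    have hW' : Wᵀ * W = 1 := (Matrix.mem_orthogonalGroup_iff' (Fin (k - r)) ℝ).1 hW
    obtain ⟨hG, hGH⟩ := hV.rotation_orthogonal s W hW'
    refine ⟨_, ⟨hG, by rw [hH]; exact hGH⟩, ?_⟩
    simp only [Matrix.mul_add, Matrix.mul_assoc]

theorem admissibleBases_eq_singleton (hX : IsOrthonormalBasisMatrix X S)
    (hXD : (Xᵀ * D).PosSemidef) (hr : (Xᵀ * D).rank = k) : admissibleBases D S = {X} := by
  obtain ⟨V₁, V₂, s, hV, hH, hs, -⟩ := exists_spectral_form _ hXD hr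
  have : IsEmpty {i : Fin k // ¬ (i : ℕ) < k} := ⟨fun i => i.2 i.1.2⟩
  have hV1 : V₁ * V₁ᵀ = 1 := by
    rw [← hV.sum, Subsingleton.elim V₂ 0, Matrix.zero_mul, add_zero]
  refine Set.Subset.antisymm ?_ (Set.singleton_subset_iff.2 ⟨hX, hXD⟩)
  rw [admissibleBases_eq_image hX hXD]
  rintro _ ⟨G, ⟨hG, hGH⟩, rfl⟩
  rw [hH] at hGH
  have h1 := hV.mul_fst_of_fixes hs hG hGH
  have h2 : G = 1 := by
    rw [← Matrix.mul_one G, ← hV1, ← Matrix.mul_assoc, h1]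
  simp [h2]

end Family

theorem theorem3p1 {n k r : ℕ} (D X X' : Matrix (Fin n) (Fin k) ℝ)
    (S S' : Submodule ℝ (Fin n → ℝ))
    (hX : IsOrthonormalBasisMatrix X S) (hXD : (Xᵀ * D).PosSemidef)
    (hX' : IsOrthonormalBasisMatrix X' S') (hXD' : (X'ᵀ * D).PosSemidef)
    (hr : (Xᵀ * D).rank = r) (hr' : (X'ᵀ * D).rank = r) :
    -- the set over which the minimum is taken, in terms of any SVD of `Xᵀ D`
    (∀ (V₁ : Matrix (Fin k) (Fin r) ℝ) (V₂ : Matrix (Fin k) (Fin (k - r)) ℝ) (s : Fin r → ℝ),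
      IsSymmSVD (Xᵀ * D) V₁ V₂ s → admissibleBases D S = basisFamily X V₁ V₂) ∧
    (r = k → admissibleBases D S = {X}) ∧
    -- the bound for every unitarily invariant norm; the minimum is attained
    (∀ ν : UnitarilyInvariantNorm, ∃ μ : ℝ,
      IsLeast ((fun Y => ν.toFun (X' - Y)) '' admissibleBases D S) μ ∧
      μ ≤ eta k r (spectralNorm2 D) (sigma (Xᵀ * D) r) (sigma (X'ᵀ * D) r) *
        ν.toFun (sinTheta X X')) ∧
    -- the improved bounds for the Frobenius and the spectral norm
    (r < k → ∃ μ : ℝ,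
      IsLeast ((fun Y => frobeniusNorm (X' - Y)) '' admissibleBases D S) μ ∧
      μ ≤ etaFrobenius r (spectralNorm2 D) (sigma (Xᵀ * D) r) (sigma (X'ᵀ * D) r) *
        frobeniusNorm (sinTheta X X')) ∧
    (r < k → ∃ μ : ℝ,
      IsLeast ((fun Y => spectralNorm2 (X' - Y)) '' admissibleBases D S) μ ∧
      μ ≤ etaSpectral r (spectralNorm2 D) (sigma (Xᵀ * D) r) (sigma (X'ᵀ * D) r) *
        spectralNorm2 (sinTheta X X')) := by
  refine ⟨fun V₁ V₂ s h => admissibleBases_eq_basisFamily hX hXD h, fun hrk =>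
    admissibleBases_eq_singleton hX hXD (hr.trans hrk), fun ν => ?_,
    exists_isLeast_frobeniusNorm_le hX hXD hX'.1 hXD' hr hr',
    exists_isLeast_spectralNorm2_le hX hXD hX'.1 hXD' hr hr'⟩
  have h := exists_isLeast_norm_le_eta ν.toGramNorm hX hXD hX'.1 hXD' hr hr'
  simpa only [UnitarilyInvariantNorm.toGramNorm, UnitarilyInvariantNorm.extend_fin] using h
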